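/- Notation. For an integer $p\ge 1$, an orthogonal $p\times p$ matrix $O$, $\sigma>0$, $\lambda\ge 1$ and $\Lambda=\sigma\,\mathrm{diag}(\lambda,1,\ldots,1)\in\mathbb{R}^{p\times p}$, let $\mathcal{E}(O,\Lambda)$ be the family of distributions $P$ of random vectors $X=O\Lambda Z$, where $Z$ is a random $p$-vector such that (i) $VZ$ and $Z$ have the same distribution for every orthogonal $V$; (ii) $R=\|Z\|$ has a Lebesgue density $f_R:(0,\infty)\to(0,\infty)$; (iii) $r\mapsto f_R(r)/r^{p-1}$ is strictly decreasing; (iv) $\mathrm{E}(R)<\infty$. For $X\sim P$ let $S_P=\mathrm{E}(XX'/\|X\|^2)$ be the spatial sign covariance matrix and $\phi_1(S_P)$ its largest eigenvalue. Theorem. There is a function $\tau(\lambda,p)$ such that, for all $p\ge 1$, $\lambda\ge 1$, $\sigma>0$, all orthogonal $O$ and all $P\in\mathcal{E}(O,\sigma\,\mathrm{diag}(\lambda,1,\ldots,1))$, $\phi_1(S_P)=\tau(\lambda,p)$, and the eigenvalues of $S_P$ with multiplicity are $\tau(\lambda,p)$ (once) and $\tau_0(\lambda,p)$ ($p-1$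 times), where $\tau_0(\lambda,p):=\{1-\tau(\lambda,p)\}/(p-1)$ for $p\ge 2$. For all $p\ge1$ and $\lambda\ge1$, $$\tau(\lambda,p)=\frac{\lambda^2}{2}\int_0^\infty(1+\lambda^2x)^{-3/2}(1+x)^{(1-p)/2}\,dx .$$ Moreover: 1. For fixed $\lambda>1$, the function $p\mapsto\tau(\lambda,p)$ is strictly decreasing on the integers $p\ge1$, and $\tau(\lambda,p)=\lambda^2/p+o(1/p)$ as $p\to\infty$. 2. For fixed $\lambda>1$, the function $p\mapsto\tau_0(\lambda,p)$ is strictly decreasing on the integers $p\ge2$, and $\tau_0(\lambda,p)=1/p+o(1/p)$ as $p\to\infty$. 3. For fixed $p\ge2$, the function $\lambda\mapsto\tau(\lambda,p)$ is strictly increasing on $[1,\infty)$, and $\tau(\lambda,p)\to1$ as $\lambda\to\infty$. 4. For every $p\ge2$ the equation $\tau(\lambda,p)=1/2$ has a unique root $\lambda_p^*$ in $[1,\infty)$. The function $p\mapsto\lambda_p^*$ is strictly increasing on the integers $p\ge 2$, and for every $\varepsilon>0$ we have $p^{1/2-\varepsilon}<\lambda_p^*<p^{1/2+\varepsilon}$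 for all $p$ large enough. 5. There is a unique $C>0$ such that $\tau(C\sqrt p,p)\to1/2$ as $p\to\infty$, and it satisfies $|C-1.634|<0.0005$. -/

import Mathlib

open MeasureTheory Filter Topology Asymptotics Set

noncomputable section

namespace SignPCA

/-- Euclidean space `ℝ^p`. -/
abbrev E (p : ℕ) : Type := EuclideanSpace ℝ (Fin p)

/-- The map `x ↦ A x` on `ℝ^p`. -/
def act {p : ℕ} (A : Matrix (Fin p) (Fin p) ℝ) (x : E p) : E p :=
  WithLp.toLp 2 (A.mulVec x.ofLp)

/-- The matrix `σ diag(lam, 1, …, 1)`. -/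
def scaleMatrix (p : ℕ) (σ lam : ℝ) : Matrix (Fin p) (Fin p) ℝ :=
  σ • Matrix.diagonal (fun i : Fin p => if i.val = 0 then lam else 1)

/-- `Z ∼ ν` is spherical: `V Z` and `Z` have the same law for every orthogonal `V`. -/
def IsSpherical {p : ℕ} (ν : Measure (E p)) : Prop :=
  ∀ V ∈ Matrix.orthogonalGroup (Fin p) ℝ, ν.map (act V) = ν

/-- For `Z ∼ ν`, the norm `R = ‖Z‖` has a positive Lebesgue density `f` on `(0, ∞)` such that
`r ↦ f r / r ^ (p - 1)` is strictly decreasing. -/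
def HasDecreasingRadialDensity {p : ℕ} (ν : Measure (E p)) : Prop :=
  ∃ f : ℝ → ℝ, Measurable f ∧ (∀ r, 0 < r → 0 < f r) ∧
    StrictAntiOn (fun r => f r / r ^ ((p : ℝ) - 1)) (Ioi 0) ∧
    ν.map (fun z => ‖z‖) =
      (volume.restrict (Ioi (0 : ℝ))).withDensity (fun r => ENNReal.ofReal (f r))

/-- The laws of `X = O Λ Z`, where `Z` is a random vector with a spherical distribution, whose norm
has a density as in `HasDecreasingRadialDensity` and a finite expectation. -/
def ellipticalFamily {p : ℕ} (O Λ : Matrix (Fin p) (Fin p) ℝ) : Set (Measure (E p)) :=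
  {P | ∃ ν : Measure (E p), IsProbabilityMeasure ν ∧ IsSpherical ν ∧
    HasDecreasingRadialDensity ν ∧ Integrable (fun z => ‖z‖) ν ∧ P = ν.map (act (O * Λ))}

/-- The spatial sign covariance matrix `E (X X' / ‖X‖²)`, `X ∼ P`. -/
def spatialSignCov {p : ℕ} (P : Measure (E p)) : Matrix (Fin p) (Fin p) ℝ :=
  Matrix.of fun i j => ∫ x, x i * x j / ‖x‖ ^ 2 ∂P

/-- `t` is the largest (real) eigenvalue of `A`. -/
def IsLeadingEigenvalue {p : ℕ} (A : Matrix (Fin p) (Fin p) ℝ) (t : ℝ) : Prop :=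
  IsGreatest {μ : ℝ | Module.End.HasEigenvalue (Matrix.toLin' A) μ} t

/-- The tail eigenvalue `(1 - τ(lam, p)) / (p - 1)`. -/
def tailEigenvalue (τ : ℝ → ℕ → ℝ) (lam : ℝ) (p : ℕ) : ℝ :=
  (1 - τ lam p) / ((p : ℝ) - 1)

end SignPCA

end

/-! The matrix `S_P` sees `Z` only through its direction, whose law is the same for every spherical
`Z` that is almost surely nonzero, so `Z` may be taken standard Gaussian. The proof needs this only
for the one kernel `signKernel`, where it follows from rotation invariance, symmetry and Fubini
(`integral_signKernel_eq_of_isSpherical`). Writing `2 / q = ∫ exp (-s q / 2) ds` for the squared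
norm in the denominator then factorises the expectation into one-dimensional Gaussian integrals,
which gives the formula for `τ` (`integral_signKernel_stdGaussian`).

Orthogonal matrices commuting with `Λ` determine the rest of the spectrum when `O = 1`: sign flips
kill the off-diagonal entries, swaps equalise the tail diagonal, and the trace is 1. Equivariance
restores `O`.

After the substitution `y = λ² x` the integrand is pointwise monotone in `a = λ⁻²` and in `p`
(`spikeInt`). Integration by parts gives `τ₀` an integral that is pointwise decreasing in `p`
(`tailEigenvalue_eq`). For fixed `λ`, `τ` lies between `λ² / (p - 3 + 3 λ²)` and `λ² / (p - 3)`.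

At the scale `λ = C √p`, dominated convergence gives the limit `limitInt (1 / (2 C²))`, strictly
increasing in `C`. This determines `C`, and it traps `λ_p^*` between `(C / 2) √p` and `2 C √p` for
large `p`. A closed form with the error function and a Taylor bound locate `C`. -/

namespace SignPCA

open ProbabilityTheory

/-! ### Orthogonal matrices acting on `ℝ^p`, and spherical laws -/

lemma measurable_act {p : ℕ} (A : Matrix (Fin p) (Fin p) ℝ) : Measurable (act A) := by
  have : Continuous (act A) := by
    unfold act
    exact (PiLp.continuous_toLp 2 _).comp
      (Continuous.matrix_mulVec continuous_const (PiLp.continuous_ofLp 2 _))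
  exact this.measurable

lemma act_apply {p : ℕ} (A : Matrix (Fin p) (Fin p) ℝ) (x : E p) (i : Fin p) :
    act A x i = ∑ k, A i k * x k := rfl

lemma act_mul {p : ℕ} (A B : Matrix (Fin p) (Fin p) ℝ) : act (A * B) = act A ∘ act B := by
  funext x
  simp [act, Matrix.mulVec_mulVec]

lemma inner_act {p : ℕ} {V : Matrix (Fin p) (Fin p) ℝ} (hV : V ∈ Matrix.orthogonalGroup (Fin p) ℝ)
    (x y : E p) : inner ℝ (act V x) (act V y) = inner ℝ x y := by
  have h : V.transpose * V = 1 := (Matrix.mem_orthogonalGroup_iff' _ _).1 hV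
  simp only [EuclideanSpace.inner_eq_star_dotProduct, act, star_trivial]
  rw [Matrix.dotProduct_mulVec, Matrix.vecMul_mulVec, ← Matrix.dotProduct_mulVec, h,
    Matrix.one_mulVec]

lemma norm_act {p : ℕ} {V : Matrix (Fin p) (Fin p) ℝ} (hV : V ∈ Matrix.orthogonalGroup (Fin p) ℝ)
    (x : E p) : ‖act V x‖ = ‖x‖ := by
  rw [norm_eq_sqrt_real_inner, inner_act hV, ← norm_eq_sqrt_real_inner]

/-- The linear isometry of `ℝ^p` given by an orthogonal matrix. -/
noncomputable def actIsometry {p : ℕ} (V : Matrix (Fin p) (Fin p) ℝ)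
    (hV : V ∈ Matrix.orthogonalGroup (Fin p) ℝ) : E p →ₗᵢ[ℝ] E p where
  toFun := act V
  map_add' x y := by simp [act, Matrix.mulVec_add]
  map_smul' c x := by simp [act, Matrix.mulVec_smul]
  norm_map' := norm_act hV

lemma exists_orthogonal_act_eq {p : ℕ} {x y : E p} (h : ‖x‖ = ‖y‖) :
    ∃ V ∈ Matrix.orthogonalGroup (Fin p) ℝ, act V x = y := by
  -- The reflection in the hyperplane orthogonal to `x - y` exchanges `x` and `y`, because their
  -- norms agree.
  let f : E p ≃ₗᵢ[ℝ] E p := (ℝ ∙ (x - y))ᗮ.reflection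
  let b := EuclideanSpace.basisFun (Fin p) ℝ
  refine ⟨(LinearMap.toMatrix b.toBasis b.toBasis) f.toLinearEquiv.toLinearMap, ?_, ?_⟩
  -- The matrix of `f` is the change of basis between the orthonormal bases `b` and `b.map f`.
  · have := b.toMatrix_orthonormalBasis_mem_orthogonal (b.map f)
    convert this using 1
    ext i j
    simp [LinearMap.toMatrix_apply, Module.Basis.toMatrix_apply]
  · have hf : f x = y := Submodule.reflection_sub h
    rw [← hf]
    have := LinearMap.toMatrix_mulVec_repr b.toBasis b.toBasis f.toLinearEquiv.toLinearMap x
    ext i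
    exact congrFun this i

lemma isSpherical_stdGaussian (p : ℕ) : IsSpherical (stdGaussian (E p)) := by
  intro V hV
  exact stdGaussian_map ((actIsometry V hV).toLinearIsometryEquiv rfl)

lemma stdGaussian_singleton_zero (n : ℕ) : stdGaussian (E (n + 1)) {0} = 0 := by
  rw [← map_pi_eq_stdGaussian, Measure.map_apply (PiLp.continuous_toLp 2 _).measurable
    (measurableSet_singleton _)]
  have : WithLp.toLp 2 ⁻¹' {(0 : E (n + 1))} = {(0 : Fin (n + 1) → ℝ)} := by
    ext x; simp
  rw [this]
  have : NullSingletonClass (gaussianReal 0 1) := nullSingletonClass_gaussianReal (by simp)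
  have := Measure.pi_nullSingletonClass (μ := fun _ : Fin (n + 1) => gaussianReal 0 1) 0
  exact measure_singleton _

lemma integral_act {p : ℕ} {ν : Measure (E p)} (hν : IsSpherical ν)
    {V : Matrix (Fin p) (Fin p) ℝ} (hV : V ∈ Matrix.orthogonalGroup (Fin p) ℝ)
    {f : E p → ℝ} (hf : Measurable f) : ∫ z, f (act V z) ∂ν = ∫ z, f z ∂ν := by
  conv_rhs => rw [← hν V hV]
  rw [integral_map (measurable_act V).aemeasurable hf.aestronglyMeasurable]

/-! ### The sign kernel and independence of the spherical law -/

/-- The kernel `lam² ⟨a, z⟩² / (‖a‖² ‖z‖² + (lam² - 1) ⟨a, z⟩²)`. -/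
noncomputable def signKernel {p : ℕ} (lam : ℝ) (a z : E p) : ℝ :=
  lam ^ 2 * inner ℝ a z ^ 2 / (‖a‖ ^ 2 * ‖z‖ ^ 2 + (lam ^ 2 - 1) * inner ℝ a z ^ 2)

lemma signKernel_comm {p : ℕ} (lam : ℝ) (a z : E p) :
    signKernel lam a z = signKernel lam z a := by
  simp only [signKernel, real_inner_comm z a, mul_comm (‖a‖ ^ 2)]

lemma signKernel_act {p : ℕ} (lam : ℝ) {V : Matrix (Fin p) (Fin p) ℝ}
    (hV : V ∈ Matrix.orthogonalGroup (Fin p) ℝ) (a z : E p) :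
    signKernel lam (act V a) (act V z) = signKernel lam a z := by
  simp only [signKernel, inner_act hV, norm_act hV]

lemma signKernel_smul {p : ℕ} (lam : ℝ) {c : ℝ} (hc : c ≠ 0) (a z : E p) :
    signKernel lam (c • a) z = signKernel lam a z := by
  simp only [signKernel, real_inner_smul_left, norm_smul, mul_pow, Real.norm_eq_abs, sq_abs]
  rw [show lam ^ 2 * (c ^ 2 * inner ℝ a z ^ 2) = c ^ 2 * (lam ^ 2 * inner ℝ a z ^ 2) by ring,
    show c ^ 2 * ‖a‖ ^ 2 * ‖z‖ ^ 2 + (lam ^ 2 - 1) * (c ^ 2 * inner ℝ a z ^ 2)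
      = c ^ 2 * (‖a‖ ^ 2 * ‖z‖ ^ 2 + (lam ^ 2 - 1) * inner ℝ a z ^ 2) by ring]
  exact mul_div_mul_left _ _ (pow_ne_zero 2 hc)

lemma abs_signKernel_le_one {p : ℕ} {lam : ℝ} (hl : 1 ≤ lam) (a z : E p) :
    |signKernel lam a z| ≤ 1 := by
  have h1 : inner ℝ a z ^ 2 ≤ ‖a‖ ^ 2 * ‖z‖ ^ 2 := by
    rw [← mul_pow]; exact sq_le_sq' (by linarith [neg_le_of_abs_le (abs_real_inner_le_norm a z)])
      (real_inner_le_norm a z)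
  have h2 : 0 ≤ (lam ^ 2 - 1) * inner ℝ a z ^ 2 :=
    mul_nonneg (by nlinarith) (sq_nonneg _)
  have h3 : 0 ≤ ‖a‖ ^ 2 * ‖z‖ ^ 2 := by positivity
  rw [signKernel, abs_of_nonneg (div_nonneg (by positivity) (by linarith))]
  exact div_le_one_of_le₀ (by linarith) (by linarith)

lemma measurable_signKernel_uncurry {p : ℕ} (lam : ℝ) :
    Measurable (Function.uncurry (signKernel (p := p) lam)) := by
  unfold signKernel Function.uncurry
  fun_prop

lemma measurable_signKernel {p : ℕ} (lam : ℝ) (a : E p) : Measurable (signKernel lam a) := by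
  unfold signKernel
  fun_prop

/-- A rotation carries `a` to `‖a‖ • e`; sphericity absorbs the same rotation applied to `z`, and
homogeneity of degree 0 removes the factor `‖a‖`. -/
lemma integral_signKernel_eq {p : ℕ} {ν : Measure (E p)} (hν : IsSpherical ν) (lam : ℝ)
    {a e : E p} (ha : a ≠ 0) (he : ‖e‖ = 1) :
    ∫ z, signKernel lam a z ∂ν = ∫ z, signKernel lam e z ∂ν := by
  have ha' : ‖a‖ ≠ 0 := norm_ne_zero_iff.2 ha
  obtain ⟨V, hV, h⟩ := exists_orthogonal_act_eq (x := a) (y := ‖a‖ • e) (by simp [norm_smul, he])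
  calc ∫ z, signKernel lam a z ∂ν = ∫ z, signKernel lam (act V a) (act V z) ∂ν := by
        simp only [signKernel_act lam hV]
    _ = ∫ z, signKernel lam (act V a) z ∂ν := integral_act hν hV (measurable_signKernel lam _)
    _ = _ := by simp only [h, signKernel_smul lam ha']

lemma ae_ne_zero {p : ℕ} {ν : Measure (E p)} (h : ν {0} = 0) : ∀ᵐ z ∂ν, z ≠ 0 := by
  rw [ae_iff]; simpa using h

/-- The direction of a spherical vector has the same law for all spherical distributions. -/
lemma integral_signKernel_eq_of_isSpherical {p : ℕ} {ν μ : Measure (E p)}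
    [IsProbabilityMeasure ν] [IsProbabilityMeasure μ] (hν : IsSpherical ν) (hμ : IsSpherical μ)
    (hν0 : ν {0} = 0) (hμ0 : μ {0} = 0) {lam : ℝ} (hl : 1 ≤ lam) {e : E p} (he : ‖e‖ = 1) :
    ∫ z, signKernel lam e z ∂ν = ∫ z, signKernel lam e z ∂μ := by
  have hint : Integrable (Function.uncurry (signKernel (p := p) lam)) (μ.prod ν) :=
    Integrable.of_bound (measurable_signKernel_uncurry lam).aestronglyMeasurable 1
      (Eventually.of_forall fun x => abs_signKernel_le_one hl _ _)
  -- Either inner integral is constant in the outer variable away from 0. Thus the two iterated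
  -- integrals of one symmetric kernel equal the `ν`-average and the `μ`-average, and Fubini
  -- identifies them.
  have h1 : ∫ a, ∫ z, signKernel lam a z ∂ν ∂μ = ∫ z, signKernel lam e z ∂ν := by
    rw [integral_congr_ae (g := fun _ => ∫ z, signKernel lam e z ∂ν)]
    · simp
    · filter_upwards [ae_ne_zero hμ0] with a ha using integral_signKernel_eq hν lam ha he
  have h2 : ∫ z, ∫ a, signKernel lam a z ∂μ ∂ν = ∫ z, signKernel lam e z ∂μ := by
    rw [integral_congr_ae (g := fun _ => ∫ z, signKernel lam e z ∂μ)]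
    · simp
    · filter_upwards [ae_ne_zero hν0] with a ha
      simp only [fun z => signKernel_comm lam z a]
      exact integral_signKernel_eq hμ lam ha he
  rw [← h1, ← h2]
  exact integral_integral_swap hint

/-! ### Gaussian evaluation of the leading entry -/

/-- The leading eigenvalue of the spatial sign covariance matrix, in its integral form. -/
noncomputable def tau (lam : ℝ) (p : ℕ) : ℝ :=
  lam ^ 2 / 2 * ∫ x in Ioi (0 : ℝ),
    (1 + lam ^ 2 * x) ^ (-(3 : ℝ) / 2) * (1 + x) ^ ((1 - (p : ℝ)) / 2)

/-- Tilting the standard normal density by `exp (-s x² / 2)` gives the `N(0, 1 / (1 + s))` density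
with total mass `(1 + s) ^ (-1/2)`. The Gaussian integrals below reduce to the mass and variance of
this law. -/
lemma exp_mul_gaussianPDFReal {s : ℝ} (hs : 0 ≤ s) (x : ℝ) :
    gaussianPDFReal 0 1 x * Real.exp (-(s * x ^ 2 / 2)) =
      (1 + s) ^ (-(1 : ℝ) / 2) * gaussianPDFReal 0 (1 + s).toNNReal⁻¹ x := by
  have h1 : 0 < 1 + s := by linarith
  have hc : (((1 + s).toNNReal⁻¹ : NNReal) : ℝ) = (1 + s)⁻¹ := by
    rw [NNReal.coe_inv, Real.coe_toNNReal _ h1.le]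
  simp only [gaussianPDFReal, hc, NNReal.coe_one, sub_zero, mul_one]
  have h2 : (1 + s) ^ (-(1 : ℝ) / 2) = (√(1 + s))⁻¹ := by
    rw [Real.sqrt_eq_rpow, ← Real.rpow_neg h1.le]; norm_num
  have h3 : √(2 * Real.pi * (1 + s)⁻¹) = √(2 * Real.pi) * (√(1 + s))⁻¹ := by
    rw [Real.sqrt_mul (by positivity), Real.sqrt_inv]
  have h4 : √(1 + s) ≠ 0 := (Real.sqrt_pos.2 h1).ne'
  rw [h2, h3, mul_assoc, ← Real.exp_add,
    show -x ^ 2 / 2 + -(s * x ^ 2 / 2) = -x ^ 2 / (2 * (1 + s)⁻¹) by field_simp; ring]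
  field_simp

lemma integral_mul_exp_gaussianReal {s : ℝ} (hs : 0 ≤ s) (g : ℝ → ℝ) :
    ∫ x, g x * Real.exp (-(s * x ^ 2 / 2)) ∂gaussianReal 0 1 =
      (1 + s) ^ (-(1 : ℝ) / 2) * ∫ x, g x ∂gaussianReal 0 (1 + s).toNNReal⁻¹ := by
  have h1 : 0 < 1 + s := by linarith
  have hv : (1 + s).toNNReal⁻¹ ≠ 0 := inv_ne_zero (by simpa using h1)
  rw [integral_gaussianReal_eq_integral_smul one_ne_zero,
    integral_gaussianReal_eq_integral_smul hv, ← integral_const_mul]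
  refine integral_congr_ae (Eventually.of_forall fun x => ?_)
  simp only [smul_eq_mul]
  linear_combination (g x) * exp_mul_gaussianPDFReal hs x

lemma integral_exp_gaussianReal {s : ℝ} (hs : 0 ≤ s) :
    ∫ x, Real.exp (-(s * x ^ 2 / 2)) ∂gaussianReal 0 1 = (1 + s) ^ (-(1 : ℝ) / 2) := by
  simpa using integral_mul_exp_gaussianReal hs (fun _ => 1)

lemma integral_sq_mul_exp_gaussianReal {s : ℝ} (hs : 0 ≤ s) :
    ∫ x, x ^ 2 * Real.exp (-(s * x ^ 2 / 2)) ∂gaussianReal 0 1 = (1 + s) ^ (-(3 : ℝ) / 2) := by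
  have h1 : 0 < 1 + s := by linarith
  rw [integral_mul_exp_gaussianReal hs (fun x => x ^ 2)]
  have h2 := variance_id_gaussianReal (μ := 0) (v := (1 + s).toNNReal⁻¹)
  rw [variance_of_integral_eq_zero aemeasurable_id (by simp)] at h2
  simp only [id_eq] at h2
  rw [h2, NNReal.coe_inv, Real.coe_toNNReal _ h1.le, ← Real.rpow_neg_one, ← Real.rpow_add h1]
  norm_num

lemma integrable_exp_gaussianReal {s : ℝ} (hs : 0 ≤ s) :
    Integrable (fun x => Real.exp (-(s * x ^ 2 / 2))) (gaussianReal 0 1) := by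
  refine Integrable.of_bound (by fun_prop) 1 (Eventually.of_forall fun x => ?_)
  rw [Real.norm_eq_abs, Real.abs_exp, Real.exp_le_one_iff]
  have := mul_nonneg hs (sq_nonneg x)
  linarith

lemma integrable_sq_mul_exp_gaussianReal {s : ℝ} (hs : 0 ≤ s) :
    Integrable (fun x => x ^ 2 * Real.exp (-(s * x ^ 2 / 2))) (gaussianReal 0 1) := by
  have h : Integrable (fun x : ℝ => x ^ 2) (gaussianReal 0 1) :=
    (memLp_id_gaussianReal (μ := 0) (v := 1) 2).integrable_sq
  refine h.mono (by fun_prop) (Eventually.of_forall fun x => ?_)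
  rw [norm_mul]
  refine mul_le_of_le_one_right (norm_nonneg _) ?_
  rw [Real.norm_eq_abs, Real.abs_exp, Real.exp_le_one_iff]
  have := mul_nonneg hs (sq_nonneg x)
  linarith

/-- The weighted squared norm `lam² z₀² + z₁² + … + zₙ²`. -/
noncomputable def spikedSq {n : ℕ} (lam : ℝ) (z : E (n + 1)) : ℝ :=
  lam ^ 2 * z 0 ^ 2 + ∑ i : Fin n, z i.succ ^ 2

lemma measurable_spikedSq {n : ℕ} (lam : ℝ) : Measurable (spikedSq (n := n) lam) := by
  unfold spikedSq
  fun_prop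

lemma norm_sq_eq_spikedSq {n : ℕ} (lam : ℝ) (z : E (n + 1)) :
    ‖z‖ ^ 2 + (lam ^ 2 - 1) * z 0 ^ 2 = spikedSq lam z := by
  rw [EuclideanSpace.norm_sq_eq, Fin.sum_univ_succ]
  simp only [Real.norm_eq_abs, sq_abs, spikedSq]
  ring

lemma spikedSq_pos {n : ℕ} {lam : ℝ} (hl : 1 ≤ lam) {z : E (n + 1)} (hz : z ≠ 0) :
    0 < spikedSq lam z := by
  rw [← norm_sq_eq_spikedSq]
  have : 0 < ‖z‖ ^ 2 := pow_pos (norm_pos_iff.2 hz) 2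
  have : 0 ≤ (lam ^ 2 - 1) * z 0 ^ 2 := mul_nonneg (by nlinarith) (sq_nonneg _)
  linarith

/-- Along the first axis the kernel is the squared first coordinate of the direction of `Λ z`: this
is what ties it to the entry `(0, 0)` of the sign covariance. -/
lemma signKernel_single {n : ℕ} (lam : ℝ) (z : E (n + 1)) :
    signKernel lam (EuclideanSpace.single 0 1) z = lam ^ 2 * z 0 ^ 2 / spikedSq lam z := by
  rw [← norm_sq_eq_spikedSq]
  simp [signKernel, EuclideanSpace.inner_single_left]

lemma mul_exp_spikedSq_eq_prod {n : ℕ} (lam s : ℝ) (z : E (n + 1)) :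
    z 0 ^ 2 * Real.exp (-(s * spikedSq lam z / 2)) =
      ∏ i, (Fin.cons (fun x : ℝ => x ^ 2 * Real.exp (-(s * lam ^ 2 * x ^ 2 / 2)))
        (fun _ x => Real.exp (-(s * x ^ 2 / 2))) : Fin (n + 1) → ℝ → ℝ) i (z i) := by
  rw [Fin.prod_univ_succ]
  simp only [Fin.cons_zero, Fin.cons_succ]
  rw [← Real.exp_sum, mul_assoc, ← Real.exp_add, Finset.sum_neg_distrib, ← Finset.sum_div,
    ← Finset.mul_sum, spikedSq]
  congr 2
  ring

lemma integrable_mul_exp_spikedSq {n : ℕ} (lam : ℝ) {s : ℝ} (hs : 0 ≤ s) :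
    Integrable (fun z : E (n + 1) => z 0 ^ 2 * Real.exp (-(s * spikedSq lam z / 2)))
      (stdGaussian (E (n + 1))) := by
  rw [← map_pi_eq_stdGaussian,
    integrable_map_measure (by have := measurable_spikedSq (n := n) lam; fun_prop)
      (PiLp.continuous_toLp 2 _).aemeasurable]
  simp only [Function.comp_def, mul_exp_spikedSq_eq_prod]
  refine Integrable.fintype_prod_dep fun i => ?_
  refine Fin.cases ?_ (fun j => ?_) i
  · simpa using integrable_sq_mul_exp_gaussianReal (s := s * lam ^ 2) (by positivity)
  · simpa using integrable_exp_gaussianReal hs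

lemma integral_mul_exp_spikedSq {n : ℕ} (lam : ℝ) {s : ℝ} (hs : 0 ≤ s) :
    ∫ z : E (n + 1), z 0 ^ 2 * Real.exp (-(s * spikedSq lam z / 2)) ∂stdGaussian (E (n + 1)) =
      (1 + lam ^ 2 * s) ^ (-(3 : ℝ) / 2) * (1 + s) ^ ((1 - ((n + 1 : ℕ) : ℝ)) / 2) := by
  rw [← map_pi_eq_stdGaussian,
    integral_map (PiLp.continuous_toLp 2 _).aemeasurable
      (by have := measurable_spikedSq (n := n) lam; fun_prop)]
  rw [integral_congr_ae (Eventually.of_forall fun x : Fin (n + 1) → ℝ =>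
    mul_exp_spikedSq_eq_prod lam s (WithLp.toLp 2 x)), integral_fintype_prod_eq_prod, Fin.prod_univ_succ]
  simp only [Fin.cons_zero, Fin.cons_succ]
  rw [integral_sq_mul_exp_gaussianReal (s := s * lam ^ 2) (by positivity),
    integral_exp_gaussianReal hs, Finset.prod_const, Finset.card_univ, Fintype.card_fin,
    ← Real.rpow_natCast _ n, ← Real.rpow_mul (by linarith), mul_comm s]
  congr 2
  push_cast
  ring

/-- This trades the denominator `q = spikedSq lam z` for an exponential, which factorises over the
independent coordinates. -/
lemma lintegral_exp_Ioi {q : ℝ} (hq : 0 < q) :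
    ∫⁻ s in Ioi (0 : ℝ), ENNReal.ofReal (Real.exp (-(s * q / 2))) = ENNReal.ofReal (2 / q) := by
  have hq2 : -(q / 2) < 0 := by linarith
  have h : ∀ s : ℝ, -(s * q / 2) = -(q / 2) * s := fun s => by ring
  simp only [h]
  rw [← ofReal_integral_eq_lintegral_ofReal (integrableOn_exp_mul_Ioi hq2 0)
    (Eventually.of_forall fun s => (Real.exp_pos _).le), integral_exp_mul_Ioi hq2 0]
  congr 1
  simp

lemma integral_signKernel_stdGaussian (n : ℕ) {lam : ℝ} (hl : 1 ≤ lam) :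
    ∫ z, signKernel lam (EuclideanSpace.single 0 1) z ∂stdGaussian (E (n + 1)) =
      tau lam (n + 1) := by
  have hm := measurable_spikedSq (n := n) lam
  have hF : Measurable (Function.uncurry fun (z : E (n + 1)) (s : ℝ) =>
      ENNReal.ofReal (lam ^ 2 / 2 * (z 0 ^ 2 * Real.exp (-(s * spikedSq lam z / 2))))) := by
    unfold Function.uncurry
    fun_prop
  rw [tau, ← integral_const_mul, integral_eq_lintegral_of_nonneg_ae,
    integral_eq_lintegral_of_nonneg_ae]
  · congr 1
    -- Tonelli for nonnegative functions swaps the two integrals without any joint integrability;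
    -- the inner Gaussian integral is then a product.
    calc _ = ∫⁻ z, (∫⁻ s in Ioi (0 : ℝ), ENNReal.ofReal
          (lam ^ 2 / 2 * (z 0 ^ 2 * Real.exp (-(s * spikedSq lam z / 2)))))
          ∂stdGaussian (E (n + 1)) := by
          refine lintegral_congr_ae ?_
          filter_upwards [ae_ne_zero (stdGaussian_singleton_zero n)] with z hz
          have hq := spikedSq_pos hl hz
          simp only [← mul_assoc]
          have : 0 ≤ lam ^ 2 / 2 * z 0 ^ 2 := by positivity
          simp only [ENNReal.ofReal_mul this]
          rw [lintegral_const_mul _ (by fun_prop), lintegral_exp_Ioi hq, ← ENNReal.ofReal_mul this,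
            signKernel_single]
          congr 1
          field_simp
      _ = ∫⁻ s in Ioi (0 : ℝ), (∫⁻ z, ENNReal.ofReal
          (lam ^ 2 / 2 * (z 0 ^ 2 * Real.exp (-(s * spikedSq lam z / 2))))
          ∂stdGaussian (E (n + 1))) := lintegral_lintegral_swap hF.aemeasurable
      _ = _ := by
          refine setLIntegral_congr_fun measurableSet_Ioi fun s hs => ?_
          have hs' : 0 ≤ s := le_of_lt hs
          simp only
          rw [← ofReal_integral_eq_lintegral_ofReal
            ((integrable_mul_exp_spikedSq lam hs').const_mul _)
            (Eventually.of_forall fun z => by positivity), integral_const_mul,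
            integral_mul_exp_spikedSq lam hs']
  · filter_upwards [ae_restrict_mem measurableSet_Ioi] with s hs
    have : (0 : ℝ) < s := hs
    simp only [Pi.zero_apply]
    positivity
  · fun_prop
  · refine Eventually.of_forall fun z => ?_
    have : 0 ≤ spikedSq lam z := by unfold spikedSq; positivity
    simp only [signKernel_single, Pi.zero_apply]
    positivity
  · exact (measurable_signKernel lam _).aestronglyMeasurable

/-! ### Spectrum of the spatial sign covariance matrix -/

lemma abs_mul_div_norm_sq_le_one {p : ℕ} (x : E p) (i j : Fin p) :
    |x i * x j / ‖x‖ ^ 2| ≤ 1 := by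
  rw [abs_div, abs_mul, abs_of_nonneg (sq_nonneg ‖x‖)]
  refine div_le_one_of_le₀ ?_ (sq_nonneg _)
  rw [sq]
  exact mul_le_mul (PiLp.norm_apply_le x i) (PiLp.norm_apply_le x j) (abs_nonneg _) (norm_nonneg _)

lemma measurable_mul_div_norm_sq {p : ℕ} (i j : Fin p) :
    Measurable fun x : E p => x i * x j / ‖x‖ ^ 2 := by
  fun_prop

lemma integrable_mul_div_norm_sq {p : ℕ} (P : Measure (E p)) [IsFiniteMeasure P] (i j : Fin p) :
    Integrable (fun x : E p => x i * x j / ‖x‖ ^ 2) P :=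
  Integrable.of_bound (measurable_mul_div_norm_sq i j).aestronglyMeasurable 1
    (Eventually.of_forall fun x => abs_mul_div_norm_sq_le_one x i j)

/-- The spatial sign covariance matrix is orthogonally equivariant. -/
lemma spatialSignCov_map_act {p : ℕ} (P : Measure (E p)) [IsFiniteMeasure P]
    {V : Matrix (Fin p) (Fin p) ℝ} (hV : V ∈ Matrix.orthogonalGroup (Fin p) ℝ) :
    spatialSignCov (P.map (act V)) = V * spatialSignCov P * V.transpose := by
  ext i j
  simp only [spatialSignCov, Matrix.of_apply, Matrix.mul_apply, Matrix.transpose_apply]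
  rw [integral_map (measurable_act V).aemeasurable
    (measurable_mul_div_norm_sq i j).aestronglyMeasurable]
  have h : ∀ x : E p, act V x i * act V x j / ‖act V x‖ ^ 2 =
      ∑ l, ∑ k, V i k * (x k * x l / ‖x‖ ^ 2) * V j l := by
    intro x
    rw [norm_act hV, act_apply, act_apply, Finset.sum_mul_sum, Finset.sum_comm, Finset.sum_div]
    refine Finset.sum_congr rfl fun l _ => ?_
    rw [Finset.sum_div]
    refine Finset.sum_congr rfl fun k _ => ?_
    ring
  simp only [h]
  have hi : ∀ k l : Fin p, Integrable (fun x : E p => V i k * (x k * x l / ‖x‖ ^ 2) * V j l) P :=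
    fun k l => ((integrable_mul_div_norm_sq P k l).const_mul _).mul_const _
  rw [integral_finsetSum _ fun l _ => integrable_finsetSum _ fun k _ => hi k l]
  refine Finset.sum_congr rfl fun l _ => ?_
  rw [integral_finsetSum _ fun k _ => hi k l, Finset.sum_mul]
  refine Finset.sum_congr rfl fun k _ => ?_
  rw [integral_mul_const, integral_const_mul]

lemma trace_spatialSignCov {p : ℕ} (P : Measure (E p)) [IsProbabilityMeasure P]
    (h0 : P {0} = 0) : (spatialSignCov P).trace = 1 := by
  simp only [Matrix.trace, Matrix.diag_apply, spatialSignCov, Matrix.of_apply]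
  rw [← integral_finsetSum _ fun i _ => integrable_mul_div_norm_sq P i i,
    integral_congr_ae (g := fun _ => 1)]
  · simp
  · filter_upwards [ae_ne_zero h0] with x hx
    have : ‖x‖ ^ 2 ≠ 0 := pow_ne_zero 2 (norm_ne_zero_iff.2 hx)
    rw [← Finset.sum_div, div_eq_one_iff_eq this, EuclideanSpace.norm_sq_eq]
    simp [sq]

/-- The law of the norm is absolutely continuous, hence has no atom at 0. This is how the radial
density enters the computation of the spectrum. -/
lemma measure_singleton_zero {p : ℕ} {ν : Measure (E p)} (h : HasDecreasingRadialDensity ν) :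
    ν {0} = 0 := by
  obtain ⟨f, -, -, -, hf⟩ := h
  have h1 : ν.map (fun z => ‖z‖) {0} = 0 := by
    rw [hf, withDensity_apply _ (measurableSet_singleton _),
      Measure.restrict_restrict (measurableSet_singleton _)]
    simp
  rw [Measure.map_apply measurable_norm (measurableSet_singleton _)] at h1
  convert h1 using 2
  ext x
  simp

lemma act_scaleMatrix_apply {n : ℕ} (σ lam : ℝ) (x : E (n + 1)) (i : Fin (n + 1)) :
    act (scaleMatrix (n + 1) σ lam) x i = σ * ((if i.val = 0 then lam else 1) * x i) := by
  simp [act, scaleMatrix, Matrix.smul_mulVec, Matrix.mulVec_diagonal]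

lemma norm_sq_act_scaleMatrix {n : ℕ} (σ lam : ℝ) (x : E (n + 1)) :
    ‖act (scaleMatrix (n + 1) σ lam) x‖ ^ 2 = σ ^ 2 * spikedSq lam x := by
  simp only [EuclideanSpace.norm_sq_eq, Real.norm_eq_abs, sq_abs, act_scaleMatrix_apply,
    Fin.sum_univ_succ, spikedSq, mul_pow, mul_add, Finset.mul_sum]
  simp

lemma act_scaleMatrix_ne_zero {n : ℕ} {σ lam : ℝ} (hσ : 0 < σ) (hl : 1 ≤ lam) {x : E (n + 1)}
    (hx : x ≠ 0) : act (scaleMatrix (n + 1) σ lam) x ≠ 0 := by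
  intro h
  have h1 := norm_sq_act_scaleMatrix σ lam x
  rw [h] at h1
  have := mul_pos (pow_pos hσ 2) (spikedSq_pos hl hx)
  simp at h1
  rcases h1 with h1 | h1
  · exact hσ.ne' h1
  · exact (spikedSq_pos hl hx).ne' h1

/-- Orthogonal matrices that commute with the scale matrix leave the law of `Λ Z` invariant. -/
lemma map_act_map_scaleMatrix {p : ℕ} {ν : Measure (E p)} (hν : IsSpherical ν) {σ lam : ℝ}
    {V : Matrix (Fin p) (Fin p) ℝ} (hV : V ∈ Matrix.orthogonalGroup (Fin p) ℝ)
    (hc : V * scaleMatrix p σ lam = scaleMatrix p σ lam * V) :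
    (ν.map (act (scaleMatrix p σ lam))).map (act V) = ν.map (act (scaleMatrix p σ lam)) := by
  rw [Measure.map_map (measurable_act _) (measurable_act _), ← act_mul, hc, act_mul,
    ← Measure.map_map (measurable_act _) (measurable_act _), hν V hV]

/-- Flipping the sign of coordinate `i` preserves the law of `Λ Z` and negates the entry `(i, j)`.
-/
lemma spatialSignCov_offDiag {p : ℕ} {ν : Measure (E p)} [IsFiniteMeasure ν]
    (hν : IsSpherical ν) (σ lam : ℝ) {i j : Fin p} (hij : i ≠ j) :
    spatialSignCov (ν.map (act (scaleMatrix p σ lam))) i j = 0 := by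
  set ε : Fin p → ℝ := fun k => if k = i then -1 else 1
  have hV : Matrix.diagonal ε ∈ Matrix.orthogonalGroup (Fin p) ℝ := by
    rw [Matrix.mem_orthogonalGroup_iff, Matrix.diagonal_transpose, Matrix.diagonal_mul_diagonal,
      ← Matrix.diagonal_one]
    congr 1
    funext k
    by_cases h : k = i <;> simp [ε, h]
  have hc : Matrix.diagonal ε * scaleMatrix p σ lam = scaleMatrix p σ lam * Matrix.diagonal ε := by
    simp [scaleMatrix, Matrix.diagonal_mul_diagonal, mul_comm]
  have h := spatialSignCov_map_act (ν.map (act (scaleMatrix p σ lam))) hV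
  rw [map_act_map_scaleMatrix hν hV hc, Matrix.diagonal_transpose] at h
  have h1 := congrFun (congrFun h i) j
  rw [Matrix.mul_diagonal, Matrix.diagonal_mul] at h1
  simp only [ε, if_pos rfl, if_neg hij.symm] at h1
  linarith

/-- Swapping two coordinates other than the spiked one commutes with `Λ`, hence preserves the law of
`Λ Z`. -/
lemma spatialSignCov_diag_eq {n : ℕ} {ν : Measure (E (n + 1))} [IsFiniteMeasure ν]
    (hν : IsSpherical ν) (σ lam : ℝ) {i j : Fin (n + 1)} (hi : i ≠ 0) (hj : j ≠ 0) :
    spatialSignCov (ν.map (act (scaleMatrix (n + 1) σ lam))) i i =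
      spatialSignCov (ν.map (act (scaleMatrix (n + 1) σ lam))) j j := by
  set V : Matrix (Fin (n + 1)) (Fin (n + 1)) ℝ := (Equiv.swap i j).permMatrix ℝ
  have hVT : V.transpose = V := by
    simp [V, Matrix.transpose_permMatrix, Equiv.swap_inv]
  have hV : V ∈ Matrix.orthogonalGroup (Fin (n + 1)) ℝ := by
    rw [Matrix.mem_orthogonalGroup_iff, hVT]
    rw [← Matrix.permMatrix_mul, Equiv.swap_mul_self, Matrix.permMatrix_one]
  have hd : ∀ k : Fin (n + 1), ((Equiv.swap i j k).val = 0) ↔ (k.val = 0) := by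
    intro k
    have h0 : ∀ m : Fin (n + 1), m.val = 0 ↔ m = 0 := fun m => Fin.val_eq_zero_iff
    rw [h0, h0]
    by_cases hki : k = i
    · simp [hki, hi, hj]
    by_cases hkj : k = j
    · simp [hkj, hi, hj]
    rw [Equiv.swap_apply_of_ne_of_ne hki hkj]
  have hVa : ∀ k l, V k l = if Equiv.swap i j k = l then 1 else 0 := by
    intro k l
    simp only [V, Equiv.Perm.permMatrix, PEquiv.toMatrix_apply, Equiv.toPEquiv_apply,
      Option.mem_some_iff]
  have hc : V * scaleMatrix (n + 1) σ lam = scaleMatrix (n + 1) σ lam * V := by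
    ext k l
    simp only [scaleMatrix, Matrix.mul_smul, Matrix.smul_mul, Matrix.smul_apply,
      Matrix.mul_diagonal, Matrix.diagonal_mul, hVa]
    by_cases h : Equiv.swap i j k = l
    · subst h
      simp only [hd]
      simp
    · simp [h]
  have h := spatialSignCov_map_act (ν.map (act (scaleMatrix (n + 1) σ lam))) hV
  rw [map_act_map_scaleMatrix hν hV hc, hVT] at h
  have h1 := congrFun (congrFun h i) i
  rw [h1]
  have hs : ∀ l, Equiv.swap i j l = i ↔ l = j := fun l => by
    rw [Equiv.swap_apply_eq_iff, Equiv.swap_apply_left]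
  simp only [Matrix.mul_apply, hVa, hs]
  simp

lemma spatialSignCov_zero_zero {n : ℕ} {ν : Measure (E (n + 1))} [IsProbabilityMeasure ν]
    (hν : IsSpherical ν) (h0 : ν {0} = 0) {σ lam : ℝ} (hσ : 0 < σ) (hl : 1 ≤ lam) :
    spatialSignCov (ν.map (act (scaleMatrix (n + 1) σ lam))) 0 0 = tau lam (n + 1) := by
  rw [← integral_signKernel_stdGaussian n hl,
    ← integral_signKernel_eq_of_isSpherical hν (isSpherical_stdGaussian _) h0
      (stdGaussian_singleton_zero n) hl (by simp)]
  simp only [spatialSignCov, Matrix.of_apply]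
  rw [integral_map (measurable_act _).aemeasurable
    (measurable_mul_div_norm_sq 0 0).aestronglyMeasurable]
  refine integral_congr_ae (Eventually.of_forall fun z => ?_)
  simp only [norm_sq_act_scaleMatrix, act_scaleMatrix_apply, signKernel_single]
  simp only [Fin.val_zero, if_true]
  rw [show σ * (lam * z 0) * (σ * (lam * z 0)) = σ ^ 2 * (lam ^ 2 * z 0 ^ 2) by ring]
  exact mul_div_mul_left _ _ (pow_ne_zero 2 hσ.ne')

lemma spatialSignCov_scaleMatrix {n : ℕ} {ν : Measure (E (n + 1))} [IsProbabilityMeasure ν]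
    (hν : IsSpherical ν) (h0 : ν {0} = 0) {σ lam : ℝ} (hσ : 0 < σ) (hl : 1 ≤ lam) :
    spatialSignCov (ν.map (act (scaleMatrix (n + 1) σ lam))) =
      Matrix.diagonal
        (Fin.cons (tau lam (n + 1)) fun _ => tailEigenvalue tau lam (n + 1)) := by
  set P := ν.map (act (scaleMatrix (n + 1) σ lam)) with hP
  have : IsProbabilityMeasure P := Measure.isProbabilityMeasure_map (measurable_act _).aemeasurable
  have hP0 : P {0} = 0 := by
    rw [hP, Measure.map_apply (measurable_act _) (measurableSet_singleton _)]
    refine measure_mono_null (fun x hx => ?_) h0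
    by_contra hx0
    exact act_scaleMatrix_ne_zero hσ hl hx0 hx
  have htr := trace_spatialSignCov P hP0
  have h00 := spatialSignCov_zero_zero hν h0 hσ hl
  ext i j
  by_cases hij : i = j
  · subst hij
    rw [Matrix.diagonal_apply_eq]
    refine Fin.cases ?_ (fun k => ?_) i
    · simpa using h00
    · simp only [Matrix.trace, Matrix.diag_apply] at htr
      -- Trace 1 reads `τ + n * (common tail entry) = 1`; here `n ≠ 0` because `k : Fin n` exists.
      rw [Fin.sum_univ_succ, Finset.sum_congr rfl fun m _ =>
        spatialSignCov_diag_eq hν σ lam (Fin.succ_ne_zero m) (Fin.succ_ne_zero k)] at htr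
      simp only [Finset.sum_const, Finset.card_univ, Fintype.card_fin, nsmul_eq_mul] at htr
      rw [← hP] at htr h00
      have hn : (n : ℝ) ≠ 0 := by
        have := k.pos
        positivity
      simp only [Fin.cons_succ, tailEigenvalue]
      rw [h00] at htr
      rw [eq_div_iff (by push_cast; simpa using hn)]
      push_cast
      linarith
  · rw [Matrix.diagonal_apply_ne _ hij, hP, spatialSignCov_offDiag hν σ lam hij]

lemma charpoly_spatialSignCov {n : ℕ} {lam σ : ℝ} {O : Matrix (Fin (n + 1)) (Fin (n + 1)) ℝ}
    {P : Measure (E (n + 1))} (hl : 1 ≤ lam) (hσ : 0 < σ)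
    (hO : O ∈ Matrix.orthogonalGroup (Fin (n + 1)) ℝ)
    (hP : P ∈ ellipticalFamily O (scaleMatrix (n + 1) σ lam)) :
    (spatialSignCov P).charpoly =
      (Polynomial.X - Polynomial.C (tau lam (n + 1))) *
        (Polynomial.X - Polynomial.C (tailEigenvalue tau lam (n + 1))) ^ n := by
  obtain ⟨ν, hν1, hν2, hν3, -, rfl⟩ := hP
  have hOO' : O.transpose * O = 1 := (Matrix.mem_orthogonalGroup_iff' _ _).1 hO
  have : IsProbabilityMeasure (ν.map (act (scaleMatrix (n + 1) σ lam))) :=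
    Measure.isProbabilityMeasure_map (measurable_act _).aemeasurable
  rw [act_mul, ← Measure.map_map (measurable_act _) (measurable_act _),
    spatialSignCov_map_act _ hO]
  rw [Matrix.charpoly_mul_comm, ← mul_assoc, hOO', one_mul,
    spatialSignCov_scaleMatrix hν2 (measure_singleton_zero hν3) hσ hl,
    Matrix.charpoly_diagonal, Fin.prod_univ_succ]
  simp

/-- The order hypothesis is conditional on `m ≠ 0` to cover `p = 1`, where `tailEigenvalue` is a
division by zero and is not an eigenvalue factor. -/
lemma isLeadingEigenvalue_of_charpoly {p m : ℕ} {A : Matrix (Fin p) (Fin p) ℝ} {s t : ℝ}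
    (h : A.charpoly = (Polynomial.X - Polynomial.C t) * (Polynomial.X - Polynomial.C s) ^ m)
    (hst : m ≠ 0 → s ≤ t) : IsLeadingEigenvalue A t := by
  have h1 : ∀ μ : ℝ, Module.End.HasEigenvalue (Matrix.toLin' A) μ ↔
      μ = t ∨ (μ = s ∧ m ≠ 0) := by
    intro μ
    rw [Module.End.hasEigenvalue_iff_isRoot_charpoly, Matrix.charpoly_toLin', h]
    simp [sub_eq_zero]
  refine ⟨(h1 t).2 (Or.inl rfl), fun μ hμ => ?_⟩
  rcases (h1 μ).1 hμ with h2 | ⟨h2, h3⟩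
  · exact h2.le
  · exact h2.le.trans (hst h3)

/-! ### Monotonicity and limits of `τ` in `λ` and `p` -/

lemma setIntegral_Ioi_lt {f g : ℝ → ℝ} {a : ℝ} (hf : IntegrableOn f (Ioi a))
    (hg : IntegrableOn g (Ioi a)) (h : ∀ x ∈ Ioi a, f x < g x) :
    ∫ x in Ioi a, f x < ∫ x in Ioi a, g x := by
  rw [← sub_pos, ← integral_sub hg hf, integral_pos_iff_support_of_nonneg_ae]
  · refine lt_of_lt_of_le (b := volume.restrict (Ioi a) (Ioi a)) (by simp) ?_
    refine measure_mono_ae ?_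
    filter_upwards [ae_restrict_mem measurableSet_Ioi] with x hx _
    exact (sub_pos.2 (h x hx)).ne'
  · filter_upwards [ae_restrict_mem measurableSet_Ioi] with x hx
    exact (sub_pos.2 (h x hx)).le
  · exact hg.sub hf

lemma integrableOn_one_add_rpow {a : ℝ} (ha : a < -1) :
    IntegrableOn (fun x : ℝ => (1 + x) ^ a) (Ioi 0) := by
  simpa only [add_comm] using
    integrableOn_add_rpow_Ioi_of_lt (c := 0) (m := 1) ha (by norm_num)

lemma integral_one_add_rpow {a : ℝ} (ha : a < -1) :
    ∫ x in Ioi (0 : ℝ), (1 + x) ^ a = -1 / (a + 1) := by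
  have h1 : a + 1 ≠ 0 := by linarith
  have hd : ∀ x ∈ Ici (0 : ℝ), HasDerivAt (fun x : ℝ => (1 + x) ^ (a + 1) / (a + 1))
      ((1 + x) ^ a) x := by
    intro x hx
    have hx' : (0 : ℝ) ≤ x := hx
    have hd : HasDerivAt (fun x : ℝ => 1 + x) 1 x := (hasDerivAt_id' x).const_add 1
    refine ((hd.rpow_const (p := a + 1) (Or.inl (by linarith))).div_const (a + 1)).congr_deriv ?_
    rw [add_sub_cancel_right]
    field_simp
  have ht : Tendsto (fun x : ℝ => (1 + x) ^ (a + 1) / (a + 1)) atTop (𝓝 (0 / (a + 1))) := by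
    refine Tendsto.div_const ?_ _
    have := (tendsto_rpow_neg_atTop (y := -(a + 1)) (by linarith)).comp
      (tendsto_atTop_add_const_left atTop (1 : ℝ) tendsto_id)
    simpa [Function.comp_def] using this
  rw [integral_Ioi_of_hasDerivAt_of_tendsto' hd (integrableOn_one_add_rpow ha) ht]
  rw [add_zero, Real.one_rpow, zero_div, zero_sub, neg_div]

/-- The leading eigenvalue as a function of `a = lam⁻²`. -/
noncomputable def spikeInt (a : ℝ) (p : ℕ) : ℝ :=
  1 / 2 * ∫ y in Ioi (0 : ℝ), (1 + y) ^ (-(3 : ℝ) / 2) * (1 + a * y) ^ ((1 - (p : ℝ)) / 2)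

lemma tau_eq_spikeInt {lam : ℝ} (hl : 0 < lam) (p : ℕ) :
    tau lam p = spikeInt (lam ^ 2)⁻¹ p := by
  have hl2 : 0 < lam ^ 2 := pow_pos hl 2
  have h := integral_comp_mul_left_Ioi (fun y : ℝ => (1 + y) ^ (-(3 : ℝ) / 2) *
    (1 + (lam ^ 2)⁻¹ * y) ^ ((1 - (p : ℝ)) / 2)) 0 hl2
  simp only [mul_zero, smul_eq_mul, inv_mul_cancel_left₀ hl2.ne'] at h
  rw [tau, h, spikeInt]
  field_simp

lemma rpow_one_sub_half_le_one {x : ℝ} (hx : 0 ≤ x) {p : ℕ} (hp : 1 ≤ p) :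
    (1 + x) ^ ((1 - (p : ℝ)) / 2) ≤ 1 := by
  have : (1 : ℝ) ≤ p := by exact_mod_cast hp
  exact Real.rpow_le_one_of_one_le_of_nonpos (by linarith) (by linarith)

lemma measurable_spikeInt_integrand (a : ℝ) (p : ℕ) :
    Measurable fun y : ℝ => (1 + y) ^ (-(3 : ℝ) / 2) * (1 + a * y) ^ ((1 - (p : ℝ)) / 2) := by
  fun_prop

lemma norm_spikeInt_integrand_le {a y : ℝ} (ha : 0 ≤ a) (hy : 0 < y) {p : ℕ} (hp : 1 ≤ p) :
    ‖(1 + y) ^ (-(3 : ℝ) / 2) * (1 + a * y) ^ ((1 - (p : ℝ)) / 2)‖ ≤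
      (1 + y) ^ (-(3 : ℝ) / 2) := by
  have h : 0 ≤ a * y := by positivity
  rw [Real.norm_of_nonneg (by positivity)]
  exact mul_le_of_le_one_right (by positivity) (rpow_one_sub_half_le_one h hp)

lemma integrableOn_spikeInt_integrand {a : ℝ} (ha : 0 ≤ a) {p : ℕ} (hp : 1 ≤ p) :
    IntegrableOn (fun y : ℝ => (1 + y) ^ (-(3 : ℝ) / 2) * (1 + a * y) ^ ((1 - (p : ℝ)) / 2))
      (Ioi 0) := by
  refine Integrable.mono' (integrableOn_one_add_rpow (a := -(3 : ℝ) / 2) (by norm_num))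
    (measurable_spikeInt_integrand a p).aestronglyMeasurable ?_
  filter_upwards [ae_restrict_mem measurableSet_Ioi] with y hy
  exact norm_spikeInt_integrand_le ha hy hp

lemma spikeInt_lt_of_lt {a : ℝ} (ha : 0 < a) {p q : ℕ} (hp : 1 ≤ p) (hpq : p < q) :
    spikeInt a q < spikeInt a p := by
  refine mul_lt_mul_of_pos_left (setIntegral_Ioi_lt (integrableOn_spikeInt_integrand ha.le
    (hp.trans hpq.le)) (integrableOn_spikeInt_integrand ha.le hp) fun y hy => ?_) (by norm_num)
  have hy' : (0 : ℝ) < y := hy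
  have h : 0 < a * y := mul_pos ha hy'
  have : (p : ℝ) < q := by exact_mod_cast hpq
  exact mul_lt_mul_of_pos_left (Real.rpow_lt_rpow_of_exponent_lt (by linarith) (by linarith))
    (by positivity)

lemma strictAntiOn_spikeInt {p : ℕ} (hp : 2 ≤ p) :
    StrictAntiOn (fun a => spikeInt a p) (Ici 0) := by
  intro a ha b hb hab
  have ha' : (0 : ℝ) ≤ a := ha
  refine mul_lt_mul_of_pos_left (setIntegral_Ioi_lt (integrableOn_spikeInt_integrand hb (by omega))
    (integrableOn_spikeInt_integrand ha (by omega)) fun y hy => ?_) (by norm_num)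
  have hy' : (0 : ℝ) < y := hy
  have h : 0 ≤ a * y := mul_nonneg ha hy'.le
  have h2 : a * y < b * y := mul_lt_mul_of_pos_right hab hy'
  have : (2 : ℝ) ≤ p := by exact_mod_cast hp
  exact mul_lt_mul_of_pos_left (Real.rpow_lt_rpow_of_neg (by linarith) (by linarith) (by linarith))
    (by positivity)

/-- The dominating function `(1 + y) ^ (-3/2)` does not depend on `a`, so continuity reaches the
endpoint `a = 0`, which stands for `λ = ∞`. -/
lemma continuousOn_spikeInt {p : ℕ} (hp : 1 ≤ p) :
    ContinuousOn (fun a => spikeInt a p) (Ici 0) := by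
  refine ContinuousOn.mul continuousOn_const ?_
  refine continuousOn_of_dominated (bound := fun y => (1 + y) ^ (-(3 : ℝ) / 2))
    (fun a _ => (measurable_spikeInt_integrand a p).aestronglyMeasurable) (fun a ha => ?_)
    (integrableOn_one_add_rpow (by norm_num)) ?_
  · filter_upwards [ae_restrict_mem measurableSet_Ioi] with y hy
    exact norm_spikeInt_integrand_le ha hy hp
  · filter_upwards [ae_restrict_mem measurableSet_Ioi] with y hy
    have hy' : (0 : ℝ) < y := hy
    refine continuousOn_const.mul (ContinuousOn.rpow_const (by fun_prop) fun a ha => Or.inl ?_)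
    have : 0 ≤ a * y := mul_nonneg ha hy'.le
    linarith

lemma spikeInt_zero (p : ℕ) : spikeInt 0 p = 1 := by
  simp only [spikeInt, zero_mul, add_zero, Real.one_rpow, mul_one]
  rw [integral_one_add_rpow (by norm_num)]
  norm_num

lemma spikeInt_one {p : ℕ} (hp : 1 ≤ p) : spikeInt 1 p = 1 / p := by
  have hp' : (1 : ℝ) ≤ p := by exact_mod_cast hp
  have h : ∫ y in Ioi (0 : ℝ), (1 + y) ^ (-(3 : ℝ) / 2) * (1 + 1 * y) ^ ((1 - (p : ℝ)) / 2) =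
      ∫ y in Ioi (0 : ℝ), (1 + y) ^ (-((p : ℝ) / 2) - 1) := by
    refine setIntegral_congr_fun measurableSet_Ioi fun y hy => ?_
    have hy' : (0 : ℝ) < y := hy
    simp only [one_mul]
    rw [← Real.rpow_add (by linarith)]
    congr 1
    ring
  rw [spikeInt, h, integral_one_add_rpow (by linarith)]
  rw [sub_add_cancel]
  field_simp

lemma strictAntiOn_tau_nat {lam : ℝ} (hl : 0 < lam) :
    StrictAntiOn (fun p : ℕ => tau lam p) (Ici 1) := by
  intro p hp q _ hpq
  simp only [tau_eq_spikeInt hl]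
  exact spikeInt_lt_of_lt (by positivity) hp hpq

lemma inv_sq_lt_inv_sq {a b : ℝ} (ha : 0 < a) (hab : a < b) : (b ^ 2)⁻¹ < (a ^ 2)⁻¹ :=
  inv_strictAnti₀ (by positivity) (pow_lt_pow_left₀ hab ha.le two_ne_zero)

/-- The domain is `(0, ∞)` and not `[1, ∞)` so that values such as `C √p / 2` can be compared with a
root without checking that they are at least 1. -/
lemma strictMonoOn_tau {p : ℕ} (hp : 2 ≤ p) :
    StrictMonoOn (fun lam : ℝ => tau lam p) (Ioi 0) := by
  intro a ha b hb hab
  simp only [tau_eq_spikeInt ha, tau_eq_spikeInt hb]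
  exact strictAntiOn_spikeInt hp (mem_Ici.2 (by positivity)) (mem_Ici.2 (by positivity))
    (inv_sq_lt_inv_sq ha hab)

lemma tendsto_tau_atTop {p : ℕ} (hp : 1 ≤ p) :
    Tendsto (fun lam : ℝ => tau lam p) atTop (𝓝 1) := by
  have h1 : Tendsto (fun a => spikeInt a p) (𝓝[Ici 0] 0) (𝓝 1) := by
    have h := (continuousOn_spikeInt hp 0 (mem_Ici.2 le_rfl)).tendsto
    rwa [spikeInt_zero] at h
  have h2 : Tendsto (fun lam : ℝ => (lam ^ 2)⁻¹) atTop (𝓝[Ici 0] 0) :=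
    tendsto_nhdsWithin_iff.2 ⟨tendsto_inv_atTop_zero.comp (tendsto_pow_atTop two_ne_zero),
      Eventually.of_forall fun x => mem_Ici.2 (by positivity)⟩
  refine (h1.comp h2).congr' ?_
  filter_upwards [eventually_gt_atTop 0] with lam hl
  simp [tau_eq_spikeInt hl]

/-- Monotonicity in `λ` compares with the isotropic case `λ = 1`, where all `p` eigenvalues equal `1
/ p`. -/
lemma one_div_le_tau {lam : ℝ} (hl : 1 ≤ lam) {p : ℕ} (hp : 2 ≤ p) : 1 / (p : ℝ) ≤ tau lam p := by
  have h := (strictMonoOn_tau hp).monotoneOn (mem_Ioi.2 one_pos) (mem_Ioi.2 (by linarith)) hl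
  simpa [tau_eq_spikeInt one_pos, spikeInt_one (show 1 ≤ p by omega)] using h

lemma tailEigenvalue_le_tau {lam : ℝ} (hl : 1 ≤ lam) {p : ℕ} (hp : 2 ≤ p) :
    tailEigenvalue tau lam p ≤ tau lam p := by
  have hp' : (2 : ℝ) ≤ p := by exact_mod_cast hp
  have h := one_div_le_tau hl hp
  rw [div_le_iff₀ (by linarith)] at h
  rw [tailEigenvalue, div_le_iff₀ (by linarith)]
  linarith

/-- Intermediate values in `a = λ⁻²` on `[0, 1]`: the function runs from 1 at `a = 0` to `1 / p ≤ 1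
/ 2` at `a = 1`. -/
lemma exists_tau_eq_half {p : ℕ} (hp : 2 ≤ p) : ∃ lam : ℝ, 1 ≤ lam ∧ tau lam p = 1 / 2 := by
  have hp' : (2 : ℝ) ≤ p := by exact_mod_cast hp
  have h1 : (1 : ℝ) / p ≤ 1 / 2 := one_div_le_one_div_of_le (by norm_num) hp'
  have hc : ContinuousOn (fun a => spikeInt a p) (Icc 0 1) :=
    (continuousOn_spikeInt (by omega)).mono Icc_subset_Ici_self
  obtain ⟨a, ⟨ha0, ha1⟩, ha⟩ := intermediate_value_Icc' zero_le_one hc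
    (show (1 / 2 : ℝ) ∈ Icc _ _ by
      simp only [spikeInt_zero, spikeInt_one (show 1 ≤ p by omega)]
      exact ⟨h1, by norm_num⟩)
  simp only at ha
  have hapos : 0 < a := by
    refine lt_of_le_of_ne ha0 fun h => ?_
    rw [← h, spikeInt_zero] at ha
    norm_num at ha
  have hs : 0 < √a := Real.sqrt_pos.2 hapos
  refine ⟨(√a)⁻¹, (one_le_inv₀ hs).2 (Real.sqrt_le_one.2 ha1), ?_⟩
  rw [tau_eq_spikeInt (by positivity), inv_pow, inv_inv, Real.sq_sqrt ha0, ha]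

/-! ### Tail eigenvalue -/

lemma integrableOn_tail_integrand {lam : ℝ} {p : ℕ} (hp : 2 ≤ p) :
    IntegrableOn (fun x : ℝ => (1 + lam ^ 2 * x) ^ (-(1 : ℝ) / 2) *
      (1 + x) ^ ((-1 - (p : ℝ)) / 2)) (Ioi 0) := by
  have hp' : (2 : ℝ) ≤ p := by exact_mod_cast hp
  refine Integrable.mono' (integrableOn_one_add_rpow (a := (-1 - (p : ℝ)) / 2) (by linarith))
    (by fun_prop) ?_
  filter_upwards [ae_restrict_mem measurableSet_Ioi] with x hx
  have hx' : (0 : ℝ) < x := hx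
  have h : 0 ≤ lam ^ 2 * x := by positivity
  rw [Real.norm_of_nonneg (by positivity)]
  exact mul_le_of_le_one_left (by positivity)
    (Real.rpow_le_one_of_one_le_of_nonpos (by linarith) (by norm_num))

lemma integrableOn_tau_integrand {lam : ℝ} (hl : 1 ≤ lam) {p : ℕ} (hp : 1 ≤ p) :
    IntegrableOn (fun x : ℝ => (1 + lam ^ 2 * x) ^ (-(3 : ℝ) / 2) *
      (1 + x) ^ ((1 - (p : ℝ)) / 2)) (Ioi 0) := by
  refine Integrable.mono' (integrableOn_one_add_rpow (a := -(3 : ℝ) / 2) (by norm_num))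
    (by fun_prop) ?_
  filter_upwards [ae_restrict_mem measurableSet_Ioi] with x hx
  have hx' : (0 : ℝ) < x := hx
  have h : x ≤ lam ^ 2 * x := le_mul_of_one_le_left hx'.le (by nlinarith)
  have h3 : 0 ≤ 1 + lam ^ 2 * x := by linarith
  rw [Real.norm_of_nonneg (by positivity)]
  refine (mul_le_of_le_one_right (by positivity) (rpow_one_sub_half_le_one hx'.le hp)).trans ?_
  exact Real.rpow_le_rpow_of_nonpos (by linarith) (by linarith) (by norm_num)

/-- The integral form of the tail eigenvalue. -/
lemma tailEigenvalue_eq {lam : ℝ} (hl : 1 ≤ lam) {p : ℕ} (hp : 2 ≤ p) :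
    tailEigenvalue tau lam p = 1 / 2 * ∫ x in Ioi (0 : ℝ),
      (1 + lam ^ 2 * x) ^ (-(1 : ℝ) / 2) * (1 + x) ^ ((-1 - (p : ℝ)) / 2) := by
  have hp' : (2 : ℝ) ≤ p := by exact_mod_cast hp
  have hl2 : 0 < lam ^ 2 := by positivity
  have hA := (integrableOn_tau_integrand hl (show 1 ≤ p by omega)).const_mul (-(lam ^ 2 / 2))
  have hB := (integrableOn_tail_integrand (lam := lam) hp).const_mul ((1 - (p : ℝ)) / 2)
  -- Integration by parts: this product falls from 1 at 0 to 0 at infinity, and the two terms of its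
  -- derivative integrate to `-τ` and `-(p - 1) τ₀`.
  have hd : ∀ x ∈ Ici (0 : ℝ), HasDerivAt
      (fun x : ℝ => (1 + lam ^ 2 * x) ^ (-(1 : ℝ) / 2) * (1 + x) ^ ((1 - (p : ℝ)) / 2))
      (-(lam ^ 2 / 2) * ((1 + lam ^ 2 * x) ^ (-(3 : ℝ) / 2) * (1 + x) ^ ((1 - (p : ℝ)) / 2)) +
        (1 - (p : ℝ)) / 2 *
          ((1 + lam ^ 2 * x) ^ (-(1 : ℝ) / 2) * (1 + x) ^ ((-1 - (p : ℝ)) / 2))) x := by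
    intro x hx
    have hx' : (0 : ℝ) ≤ x := hx
    have h3 : 0 ≤ lam ^ 2 * x := by positivity
    have h1 : HasDerivAt (fun x : ℝ => 1 + lam ^ 2 * x) (lam ^ 2) x := by
      simpa using ((hasDerivAt_id' x).const_mul (lam ^ 2)).const_add 1
    have h2 : HasDerivAt (fun x : ℝ => 1 + x) 1 x := (hasDerivAt_id' x).const_add 1
    refine ((h1.rpow_const (p := -(1 : ℝ) / 2) (Or.inl (by linarith))).mul
      (h2.rpow_const (p := (1 - (p : ℝ)) / 2) (Or.inl (by linarith)))).congr_deriv ?_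
    rw [show (-(1 : ℝ) / 2 - 1) = -(3 : ℝ) / 2 by norm_num,
      show (1 - (p : ℝ)) / 2 - 1 = (-1 - (p : ℝ)) / 2 by ring]
    ring
  have ht : Tendsto
      (fun x : ℝ => (1 + lam ^ 2 * x) ^ (-(1 : ℝ) / 2) * (1 + x) ^ ((1 - (p : ℝ)) / 2))
      atTop (𝓝 0) := by
    have h1 : Tendsto (fun x : ℝ => (1 + lam ^ 2 * x) ^ (-(1 : ℝ) / 2)) atTop (𝓝 0) := by
      have := (tendsto_rpow_neg_atTop (y := (1 : ℝ) / 2) (by norm_num)).comp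
        (tendsto_atTop_add_const_left atTop (1 : ℝ) (tendsto_id.const_mul_atTop hl2))
      simpa only [Function.comp_def, neg_div, id] using this
    refine squeeze_zero' ?_ ?_ h1
    · filter_upwards [eventually_ge_atTop 0] with x hx
      positivity
    · filter_upwards [eventually_ge_atTop 0] with x hx
      exact mul_le_of_le_one_right (by positivity) (rpow_one_sub_half_le_one hx (by omega))
  have h := integral_Ioi_of_hasDerivAt_of_tendsto' hd (hA.add hB) ht
  rw [integral_add hA hB, integral_const_mul, integral_const_mul] at h
  simp only [mul_zero, add_zero, Real.one_rpow, mul_one, zero_sub] at h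
  have hne : (p : ℝ) - 1 ≠ 0 := by linarith
  rw [tailEigenvalue, div_eq_iff hne, tau]
  linarith

lemma strictAntiOn_tailEigenvalue {lam : ℝ} (hl : 1 ≤ lam) :
    StrictAntiOn (fun p : ℕ => tailEigenvalue tau lam p) (Ici 2) := by
  intro p hp q hq hpq
  simp only [tailEigenvalue_eq hl hp, tailEigenvalue_eq hl hq]
  refine mul_lt_mul_of_pos_left (setIntegral_Ioi_lt (integrableOn_tail_integrand hq)
    (integrableOn_tail_integrand hp) fun y hy => ?_) (by norm_num)
  have hy' : (0 : ℝ) < y := hy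
  have : (p : ℝ) < q := by exact_mod_cast hpq
  exact mul_lt_mul_of_pos_left (Real.rpow_lt_rpow_of_exponent_lt (by linarith) (by linarith))
    (by positivity)

/-! ### Asymptotics in `p` for fixed `λ` -/

lemma tau_le {lam : ℝ} {p : ℕ} (hp : 3 < p) :
    tau lam p ≤ lam ^ 2 / ((p : ℝ) - 3) := by
  have hp' : (3 : ℝ) < p := by exact_mod_cast hp
  have he : (1 - (p : ℝ)) / 2 < -1 := by linarith
  have h : ∫ x in Ioi (0 : ℝ), (1 + lam ^ 2 * x) ^ (-(3 : ℝ) / 2) * (1 + x) ^ ((1 - (p : ℝ)) / 2)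
      ≤ ∫ x in Ioi (0 : ℝ), (1 + x) ^ ((1 - (p : ℝ)) / 2) := by
    refine integral_mono_of_nonneg ?_ (integrableOn_one_add_rpow he) ?_
    · filter_upwards [ae_restrict_mem measurableSet_Ioi] with x hx
      have hx' : (0 : ℝ) < x := hx
      simp only [Pi.zero_apply]
      positivity
    · filter_upwards [ae_restrict_mem measurableSet_Ioi] with x hx
      have hx' : (0 : ℝ) < x := hx
      have h : 0 ≤ lam ^ 2 * x := by positivity
      exact mul_le_of_le_one_left (by positivity)
        (Real.rpow_le_one_of_one_le_of_nonpos (by linarith) (by norm_num))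
  rw [integral_one_add_rpow he] at h
  refine (mul_le_mul_of_nonneg_left h (by positivity)).trans_eq ?_
  have h1 : (p : ℝ) - 3 ≠ 0 := by linarith
  have h2 : (1 - (p : ℝ)) / 2 + 1 ≠ 0 := by linarith
  rw [div_mul_div_comm, div_eq_div_iff (mul_ne_zero two_ne_zero h2) h1]
  ring

lemma le_tau {lam : ℝ} (hl : 1 ≤ lam) {p : ℕ} (hp : 1 ≤ p) :
    lam ^ 2 / ((p : ℝ) - 3 + 3 * lam ^ 2) ≤ tau lam p := by
  have hp' : (1 : ℝ) ≤ p := by exact_mod_cast hp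
  have hl2 : 1 ≤ lam ^ 2 := one_le_pow₀ hl
  have he : (1 - (p : ℝ)) / 2 - 3 / 2 * lam ^ 2 < -1 := by linarith
  have h : ∫ x in Ioi (0 : ℝ), (1 + x) ^ ((1 - (p : ℝ)) / 2 - 3 / 2 * lam ^ 2) ≤
      ∫ x in Ioi (0 : ℝ), (1 + lam ^ 2 * x) ^ (-(3 : ℝ) / 2) *
        (1 + x) ^ ((1 - (p : ℝ)) / 2) := by
    refine setIntegral_mono_on (integrableOn_one_add_rpow he)
      (integrableOn_tau_integrand hl hp) measurableSet_Ioi fun x hx => ?_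
    have hx' : (0 : ℝ) < x := hx
    -- Bernoulli's inequality turns the first factor into a power of `1 + x`, so the lower bound is
    -- an explicit integral.
    have h1 : 1 + lam ^ 2 * x ≤ (1 + x) ^ (lam ^ 2) := by
      exact one_add_mul_self_le_rpow_one_add (by linarith) hl2
    have h2 : (1 + x) ^ ((1 - (p : ℝ)) / 2 - 3 / 2 * lam ^ 2) =
        ((1 + x) ^ (lam ^ 2)) ^ (-(3 : ℝ) / 2) * (1 + x) ^ ((1 - (p : ℝ)) / 2) := by
      rw [← Real.rpow_mul (by linarith), ← Real.rpow_add (by linarith)]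
      congr 1
      ring
    rw [h2]
    refine mul_le_mul_of_nonneg_right ?_ (by positivity)
    exact Real.rpow_le_rpow_of_nonpos (by positivity) h1 (by norm_num)
  rw [integral_one_add_rpow he] at h
  refine le_trans (le_of_eq ?_) (mul_le_mul_of_nonneg_left h (by positivity))
  have h1 : (p : ℝ) - 3 + 3 * lam ^ 2 ≠ 0 := by linarith
  have h2 : (1 - (p : ℝ)) / 2 - 3 / 2 * lam ^ 2 + 1 ≠ 0 := by linarith
  rw [div_mul_div_comm, div_eq_div_iff h1 (mul_ne_zero two_ne_zero h2)]
  ring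

lemma tendsto_natCast_div_add (c : ℝ) :
    Tendsto (fun p : ℕ => (p : ℝ) / ((p : ℝ) + c)) atTop (𝓝 1) := by
  have h : Tendsto (fun p : ℕ => (1 + c / (p : ℝ))⁻¹) atTop (𝓝 1) := by
    have := ((tendsto_const_div_atTop_nhds_zero_nat c).const_add 1).inv₀ (by norm_num)
    simpa using this
  refine h.congr' ?_
  filter_upwards [eventually_gt_atTop 0] with p hp
  have : (p : ℝ) ≠ 0 := by positivity
  rw [one_add_div this, inv_div]

lemma tendsto_mul_tau {lam : ℝ} (hl : 1 ≤ lam) :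
    Tendsto (fun p : ℕ => (p : ℝ) * tau lam p) atTop (𝓝 (lam ^ 2)) := by
  have h1 := (tendsto_natCast_div_add (-3 + 3 * lam ^ 2)).const_mul (lam ^ 2)
  have h2 := (tendsto_natCast_div_add (-3)).const_mul (lam ^ 2)
  rw [mul_one] at h1 h2
  refine tendsto_of_tendsto_of_tendsto_of_le_of_le' h1 h2 ?_ ?_
  · filter_upwards [eventually_ge_atTop 1] with p hp
    refine le_trans (le_of_eq ?_) (mul_le_mul_of_nonneg_left (le_tau hl hp) (Nat.cast_nonneg p))
    rw [← add_assoc, ← sub_eq_add_neg]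
    ring
  · filter_upwards [eventually_gt_atTop 3] with p hp
    refine (mul_le_mul_of_nonneg_left (tau_le hp) (Nat.cast_nonneg p)).trans_eq ?_
    rw [← sub_eq_add_neg]
    ring

lemma isLittleO_one_div_of_tendsto {f : ℕ → ℝ} {c : ℝ}
    (h : Tendsto (fun p : ℕ => (p : ℝ) * f p) atTop (𝓝 c)) :
    (fun p : ℕ => f p - c / (p : ℝ)) =o[atTop] (fun p : ℕ => 1 / (p : ℝ)) := by
  rw [isLittleO_iff_tendsto']
  · have h1 := h.sub_const c
    rw [sub_self] at h1
    refine h1.congr' ?_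
    filter_upwards [eventually_gt_atTop 0] with p hp
    have : (p : ℝ) ≠ 0 := by positivity
    field_simp
  · filter_upwards [eventually_gt_atTop 0] with p hp h0
    have : (p : ℝ) ≠ 0 := by positivity
    simp [this] at h0

lemma tendsto_mul_tailEigenvalue {lam : ℝ} (hl : 1 ≤ lam) :
    Tendsto (fun p : ℕ => (p : ℝ) * tailEigenvalue tau lam p) atTop (𝓝 1) := by
  have h1 : Tendsto (fun p : ℕ => tau lam p) atTop (𝓝 0) := by
    have h := (tendsto_mul_tau hl).mul tendsto_one_div_atTop_nhds_zero_nat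
    rw [mul_zero] at h
    refine h.congr' ?_
    filter_upwards [eventually_gt_atTop 0] with p hp
    have : (p : ℝ) ≠ 0 := by positivity
    field_simp
  have h2 := (tendsto_natCast_div_add (-1)).mul (h1.const_sub 1)
  rw [sub_zero, mul_one] at h2
  refine h2.congr fun p => ?_
  rw [tailEigenvalue, ← sub_eq_add_neg]
  ring

/-! ### The scale `λ = C √p` -/

/-- The limit of `tau (C √p) p`, as a function of `b = 1 / (2 C²)`. -/
noncomputable def limitInt (b : ℝ) : ℝ :=
  1 / 2 * ∫ y in Ioi (0 : ℝ), (1 + y) ^ (-(3 : ℝ) / 2) * Real.exp (-(b * y))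

lemma norm_limitInt_integrand_le {b y : ℝ} (hb : 0 ≤ b) (hy : 0 < y) :
    ‖(1 + y) ^ (-(3 : ℝ) / 2) * Real.exp (-(b * y))‖ ≤ (1 + y) ^ (-(3 : ℝ) / 2) := by
  have h : 0 ≤ b * y := by positivity
  rw [Real.norm_of_nonneg (by positivity)]
  exact mul_le_of_le_one_right (by positivity) (Real.exp_le_one_iff.2 (by linarith))

lemma integrableOn_limitInt_integrand {b : ℝ} (hb : 0 ≤ b) :
    IntegrableOn (fun y : ℝ => (1 + y) ^ (-(3 : ℝ) / 2) * Real.exp (-(b * y))) (Ioi 0) := by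
  refine Integrable.mono' (integrableOn_one_add_rpow (a := -(3 : ℝ) / 2) (by norm_num))
    (by fun_prop) ?_
  filter_upwards [ae_restrict_mem measurableSet_Ioi] with y hy
  exact norm_limitInt_integrand_le hb hy

lemma strictAntiOn_limitInt : StrictAntiOn limitInt (Ici 0) := by
  intro a ha b hb hab
  refine mul_lt_mul_of_pos_left (setIntegral_Ioi_lt (integrableOn_limitInt_integrand hb)
    (integrableOn_limitInt_integrand ha) fun y hy => ?_) (by norm_num)
  have hy' : (0 : ℝ) < y := hy
  have h2 : a * y < b * y := mul_lt_mul_of_pos_right hab hy'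
  exact mul_lt_mul_of_pos_left (Real.exp_lt_exp.2 (by linarith)) (by positivity)

lemma continuousOn_limitInt : ContinuousOn limitInt (Ici 0) := by
  refine ContinuousOn.mul continuousOn_const ?_
  refine continuousOn_of_dominated (bound := fun y => (1 + y) ^ (-(3 : ℝ) / 2))
    (fun b hb => (integrableOn_limitInt_integrand hb).aestronglyMeasurable) (fun a ha => ?_)
    (integrableOn_one_add_rpow (by norm_num)) (Eventually.of_forall fun y => by fun_prop)
  filter_upwards [ae_restrict_mem measurableSet_Ioi] with y hy
  exact norm_limitInt_integrand_le ha hy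

/-- The exponent splits as `p * (-1/2) + 1/2`: the first part gives the exponential limit, the
second tends to 1. -/
lemma tendsto_one_add_div_rpow_half (t : ℝ) :
    Tendsto (fun p : ℕ => (1 + t / (p : ℝ)) ^ ((1 - (p : ℝ)) / 2)) atTop
      (𝓝 (Real.exp (-(t / 2)))) := by
  have h0 : Tendsto (fun p : ℕ => 1 + t / (p : ℝ)) atTop (𝓝 1) := by
    simpa using (tendsto_const_div_atTop_nhds_zero_nat t).const_add 1
  have h1 : Tendsto (fun p : ℕ => ((1 + t / (p : ℝ)) ^ p) ^ (-(1 : ℝ) / 2)) atTop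
      (𝓝 (Real.exp t ^ (-(1 : ℝ) / 2))) :=
    (Real.tendsto_one_add_div_pow_exp t).rpow_const (Or.inl (Real.exp_pos t).ne')
  have h2 : Tendsto (fun p : ℕ => (1 + t / (p : ℝ)) ^ ((1 : ℝ) / 2)) atTop (𝓝 1) := by
    simpa using h0.rpow_const (p := (1 : ℝ) / 2) (Or.inl one_ne_zero)
  have h3 := h1.mul h2
  rw [mul_one, ← Real.exp_mul] at h3
  rw [show -(t / 2) = t * (-(1 : ℝ) / 2) by ring]
  refine h3.congr' ?_
  filter_upwards [h0.eventually (lt_mem_nhds one_pos)] with p hp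
  rw [← Real.rpow_natCast, ← Real.rpow_mul hp.le, ← Real.rpow_add hp]
  congr 1
  ring

lemma tendsto_tau_mul_sqrt {C : ℝ} (hC : 0 < C) :
    Tendsto (fun p : ℕ => tau (C * √(p : ℝ)) p) atTop (𝓝 (limitInt (2 * C ^ 2)⁻¹)) := by
  have h : Tendsto (fun p : ℕ => spikeInt ((C * √(p : ℝ)) ^ 2)⁻¹ p) atTop
      (𝓝 (limitInt (2 * C ^ 2)⁻¹)) := by
    refine Tendsto.const_mul _ ?_
    refine tendsto_integral_filter_of_dominated_convergence
      (fun y => (1 + y) ^ (-(3 : ℝ) / 2)) ?_ ?_ (integrableOn_one_add_rpow (by norm_num)) ?_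
    · exact Eventually.of_forall fun p =>
        (measurable_spikeInt_integrand _ p).aestronglyMeasurable
    · filter_upwards [eventually_ge_atTop 1] with p hp
      filter_upwards [ae_restrict_mem measurableSet_Ioi] with y hy
      exact norm_spikeInt_integrand_le (by positivity) hy hp
    · refine Eventually.of_forall fun y => Tendsto.const_mul _ ?_
      have h := tendsto_one_add_div_rpow_half (y / C ^ 2)
      rw [show (2 * C ^ 2)⁻¹ * y = y / C ^ 2 / 2 by field_simp]
      refine h.congr fun p => ?_
      rw [mul_pow, Real.sq_sqrt (Nat.cast_nonneg p), mul_inv, div_div, div_eq_mul_inv, mul_inv,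
        mul_comm y]
  refine h.congr' ?_
  filter_upwards [eventually_gt_atTop 0] with p hp
  have hp' : (0 : ℝ) < p := by exact_mod_cast hp
  rw [tau_eq_spikeInt (mul_pos hC (Real.sqrt_pos.2 hp'))]

/-! ### Closed form of the limit and numerical location of `C` -/

/-- The unnormalised error function. -/
noncomputable def gaussPrimitive (t : ℝ) : ℝ := ∫ u in (0 : ℝ)..t, Real.exp (-u ^ 2)

lemma hasDerivAt_gaussPrimitive (t : ℝ) : HasDerivAt gaussPrimitive (Real.exp (-t ^ 2)) t :=
  (by fun_prop : Continuous fun u : ℝ => Real.exp (-u ^ 2)).integral_hasStrictDerivAt 0 t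
    |>.hasDerivAt

lemma tendsto_gaussPrimitive : Tendsto gaussPrimitive atTop (𝓝 (√Real.pi / 2)) := by
  have h := integral_gaussian_Ioi 1
  have hi : IntegrableOn (fun u : ℝ => Real.exp (-1 * u ^ 2)) (Ioi 0) :=
    (integrable_exp_neg_mul_sq one_pos).integrableOn
  rw [div_one] at h
  rw [← h]
  simp only [neg_mul, one_mul] at hi ⊢
  exact intervalIntegral_tendsto_integral_Ioi 0 hi tendsto_id

lemma limitInt_sq {t : ℝ} (ht : 0 < t) :
    limitInt (t ^ 2) = 1 - 2 * t * Real.exp (t ^ 2) * (√Real.pi / 2 - gaussPrimitive t) := by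
  -- This primitive comes from integrating `(1 + y) ^ (-3/2)` by parts and substituting `u = t √(1 +
  -- y)` in the remaining integral.
  have hd : ∀ y ∈ Ici (0 : ℝ), HasDerivAt
      (fun y : ℝ => -((1 + y) ^ (-(1 : ℝ) / 2) * Real.exp (-(t ^ 2 * y))) -
        2 * t * Real.exp (t ^ 2) * gaussPrimitive (t * √(1 + y)))
      (1 / 2 * ((1 + y) ^ (-(3 : ℝ) / 2) * Real.exp (-(t ^ 2 * y)))) y := by
    intro y hy
    have hy' : (0 : ℝ) ≤ y := hy
    have hy1 : 0 < 1 + y := by linarith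
    have h1 : HasDerivAt (fun y : ℝ => 1 + y) 1 y := (hasDerivAt_id' y).const_add 1
    have h2 : HasDerivAt (fun y : ℝ => Real.exp (-(t ^ 2 * y)))
        (Real.exp (-(t ^ 2 * y)) * -(t ^ 2)) y := by
      simpa using ((hasDerivAt_id' y).const_mul (t ^ 2)).neg.exp
    have h3 := (hasDerivAt_gaussPrimitive (t * √(1 + y))).comp y
      ((h1.sqrt hy1.ne').const_mul t)
    have h4 := ((h1.rpow_const (p := -(1 : ℝ) / 2) (Or.inl hy1.ne')).mul h2).neg.sub
      (h3.const_mul (2 * t * Real.exp (t ^ 2)))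
    refine h4.congr_deriv ?_
    have h5 : Real.exp (-(t * √(1 + y)) ^ 2) = Real.exp (-t ^ 2) * Real.exp (-(t ^ 2 * y)) := by
      rw [← Real.exp_add, mul_pow, Real.sq_sqrt hy1.le]
      congr 1
      ring
    have h6 : (1 + y) ^ (-(1 : ℝ) / 2) = (√(1 + y))⁻¹ := by
      rw [Real.sqrt_eq_rpow, ← Real.rpow_neg hy1.le]; norm_num
    have h7 : Real.exp (t ^ 2) * Real.exp (-t ^ 2) = 1 := by
      rw [← Real.exp_add]; simp
    rw [h5, h6, show (-(1 : ℝ) / 2 - 1) = -(3 : ℝ) / 2 by norm_num]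
    have h8 : √(1 + y) ≠ 0 := (Real.sqrt_pos.2 hy1).ne'
    field_simp
    linear_combination (-2 * t ^ 2) * h7
  have hlim : Tendsto (fun y : ℝ => -((1 + y) ^ (-(1 : ℝ) / 2) * Real.exp (-(t ^ 2 * y))) -
        2 * t * Real.exp (t ^ 2) * gaussPrimitive (t * √(1 + y))) atTop
        (𝓝 (-0 - 2 * t * Real.exp (t ^ 2) * (√Real.pi / 2))) := by
    have hadd : Tendsto (fun y : ℝ => 1 + y) atTop atTop :=
      tendsto_atTop_add_const_left atTop (1 : ℝ) tendsto_id
    refine Tendsto.sub (Tendsto.neg ?_) (Tendsto.const_mul _ ?_)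
    · have h1 : Tendsto (fun y : ℝ => (1 + y) ^ (-(1 : ℝ) / 2)) atTop (𝓝 0) := by
        have := (tendsto_rpow_neg_atTop (y := (1 : ℝ) / 2) (by norm_num)).comp hadd
        simpa only [Function.comp_def, neg_div] using this
      refine squeeze_zero' ?_ ?_ h1
      · filter_upwards [eventually_ge_atTop 0] with x hx
        positivity
      · filter_upwards [eventually_ge_atTop 0] with x hx
        have : 0 ≤ t ^ 2 * x := by positivity
        exact mul_le_of_le_one_right (by positivity) (Real.exp_le_one_iff.2 (by linarith))
    · exact tendsto_gaussPrimitive.comp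
        ((Real.tendsto_sqrt_atTop.comp hadd).const_mul_atTop ht)
  have h := integral_Ioi_of_hasDerivAt_of_tendsto' hd
    ((integrableOn_limitInt_integrand (sq_nonneg t)).const_mul (1 / 2)) hlim
  rw [limitInt, ← integral_const_mul, h]
  simp
  ring

lemma abs_exp_neg_sub_le {u : ℝ} (h0 : 0 ≤ u) (h1 : u ≤ 1) :
    |Real.exp (-u) - (1 - u + u ^ 2 / 2 - u ^ 3 / 6 + u ^ 4 / 24)| ≤ u ^ 5 / 100 := by
  have h := Real.exp_bound (x := -u) (by rwa [abs_neg, abs_of_nonneg h0]) (n := 5) (by norm_num)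
  rw [abs_neg, abs_of_nonneg h0] at h
  norm_num [Finset.sum_range_succ, Nat.factorial] at h
  convert h using 1
  · congr 1
    ring
  · ring

/-- Termwise integration of the preceding Taylor bound at `u ^ 2`; the error `u ^ 10 / 100`
integrates to `t ^ 11 / 1100`. -/
lemma abs_gaussPrimitive_sub_le {t : ℝ} (h0 : 0 ≤ t) (h1 : t ≤ 1) :
    |gaussPrimitive t - (t - t ^ 3 / 3 + t ^ 5 / 10 - t ^ 7 / 42 + t ^ 9 / 216)| ≤
      t ^ 11 / 1100 := by
  have hp : ∫ u in (0 : ℝ)..t, (1 - u ^ 2 + u ^ 4 / 2 - u ^ 6 / 6 + u ^ 8 / 24) =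
      t - t ^ 3 / 3 + t ^ 5 / 10 - t ^ 7 / 42 + t ^ 9 / 216 := by
    rw [intervalIntegral.integral_eq_sub_of_hasDerivAt
      (f := fun u => u - u ^ 3 / 3 + u ^ 5 / 10 - u ^ 7 / 42 + u ^ 9 / 216)]
    · simp
    · intro u _
      refine (((((hasDerivAt_id' u).sub ((hasDerivAt_pow 3 u).div_const 3)).add
        ((hasDerivAt_pow 5 u).div_const 10)).sub ((hasDerivAt_pow 7 u).div_const 42)).add
        ((hasDerivAt_pow 9 u).div_const 216)).congr_deriv ?_
      norm_num
      ring
    · exact Continuous.intervalIntegrable (by fun_prop) _ _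
  have he : ∫ u in (0 : ℝ)..t, u ^ 10 / 100 = t ^ 11 / 1100 := by
    rw [intervalIntegral.integral_div, integral_pow]
    norm_num
    ring
  rw [← hp, ← he, gaussPrimitive, ← intervalIntegral.integral_sub
    (Continuous.intervalIntegrable (by fun_prop) _ _)
    (Continuous.intervalIntegrable (by fun_prop) _ _), ← Real.norm_eq_abs]
  refine intervalIntegral.norm_integral_le_of_norm_le h0 (Eventually.of_forall fun u hu => ?_)
    (Continuous.intervalIntegrable (by fun_prop) _ _)
  have h := abs_exp_neg_sub_le (u := u ^ 2) (sq_nonneg u)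
    (pow_le_one₀ hu.1.le (hu.2.trans h1))
  rw [Real.norm_eq_abs]
  convert h using 1
  · congr 1
    ring
  · ring

lemma sqrt_pi_bounds : 1.77245 < √Real.pi ∧ √Real.pi < 1.77246 := by
  constructor
  · rw [Real.lt_sqrt (by norm_num)]
    linarith [Real.pi_gt_d6, (by norm_num : (1.77245 : ℝ) ^ 2 < 3.141592)]
  · rw [Real.sqrt_lt' (by norm_num)]
    linarith [Real.pi_lt_d4, (by norm_num : (3.1416 : ℝ) < 1.77246 ^ 2)]

/-- With `t = 1 / (√2 C)`, the bounds `1.6335 < C < 1.6345` correspond to `t` between about 0.432614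
and 0.432878; the test points 0.43262 and 0.43287 lie just inside. -/
lemma half_lt_limitInt : 1 / 2 < limitInt (0.43262 ^ 2) := by
  rw [limitInt_sq (by norm_num)]
  have h1 := abs_le.1 (abs_gaussPrimitive_sub_le (t := 0.43262) (by norm_num) (by norm_num))
  have h2 := abs_le.1 (abs_exp_neg_sub_le (u := 0.43262 ^ 2) (by norm_num) (by norm_num))
  have h3 : Real.exp (0.43262 ^ 2) * Real.exp (-0.43262 ^ 2) = 1 := by
    rw [← Real.exp_add]; simp
  have h4 := Real.exp_pos (0.43262 ^ 2)
  -- The claim multiplied by `2 exp (-t²)`, so that only `exp (-t²)`, `√π` and `gaussPrimitive t`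
  -- need numerical bounds.
  have h5 : 4 * 0.43262 * (√Real.pi / 2 - gaussPrimitive 0.43262) < Real.exp (-0.43262 ^ 2) := by
    have := sqrt_pi_bounds.2
    norm_num at h1 h2 ⊢
    linarith [h1.1, h2.1]
  have h6 := mul_lt_mul_of_pos_left h5 h4
  rw [h3] at h6
  linarith

lemma limitInt_lt_half : limitInt (0.43287 ^ 2) < 1 / 2 := by
  rw [limitInt_sq (by norm_num)]
  have h1 := abs_le.1 (abs_gaussPrimitive_sub_le (t := 0.43287) (by norm_num) (by norm_num))
  have h2 := abs_le.1 (abs_exp_neg_sub_le (u := 0.43287 ^ 2) (by norm_num) (by norm_num))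
  have h3 : Real.exp (0.43287 ^ 2) * Real.exp (-0.43287 ^ 2) = 1 := by
    rw [← Real.exp_add]; simp
  have h4 := Real.exp_pos (0.43287 ^ 2)
  have h5 : Real.exp (-0.43287 ^ 2) < 4 * 0.43287 * (√Real.pi / 2 - gaussPrimitive 0.43287) := by
    have := sqrt_pi_bounds.1
    norm_num at h1 h2 ⊢
    linarith [h1.2, h2.2]
  have h6 := mul_lt_mul_of_pos_left h5 h4
  rw [h3] at h6
  linarith

lemma exists_limitInt_eq_half : ∃ C : ℝ, 0 < C ∧ limitInt (2 * C ^ 2)⁻¹ = 1 / 2 ∧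
    |C - 1.634| < 0.0005 := by
  have hc : ContinuousOn limitInt (Icc (0.43262 ^ 2) (0.43287 ^ 2)) :=
    continuousOn_limitInt.mono fun x hx => mem_Ici.2 ((sq_nonneg (0.43262 : ℝ)).trans hx.1)
  obtain ⟨b, ⟨hb0, hb1⟩, hb⟩ := intermediate_value_Icc' (by norm_num) hc
    ⟨limitInt_lt_half.le, half_lt_limitInt.le⟩
  have hb2 : 0 < b := lt_of_lt_of_le (by norm_num) hb0
  have hC : 0 < √(2 * b)⁻¹ := Real.sqrt_pos.2 (by positivity)
  refine ⟨√(2 * b)⁻¹, hC, ?_, ?_⟩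
  · rw [Real.sq_sqrt (by positivity), show (2 * (2 * b)⁻¹)⁻¹ = b by field_simp, hb]
  · have h1 : √(2 * b)⁻¹ < 1.6345 := by
      rw [Real.sqrt_lt' (by norm_num), inv_lt_comm₀ (by positivity) (by norm_num)]
      refine lt_of_lt_of_le ?_ (mul_le_mul_of_nonneg_left hb0 zero_le_two)
      norm_num
    have h2 : 1.6335 < √(2 * b)⁻¹ := by
      rw [Real.lt_sqrt (by norm_num), lt_inv_comm₀ (by norm_num) (by positivity)]
      refine lt_of_le_of_lt (mul_le_mul_of_nonneg_left hb1 zero_le_two) ?_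
      norm_num
    rw [abs_lt]
    constructor <;> linarith

lemma limitInt_lt_of_lt {C C' : ℝ} (hC : 0 < C) (h : C < C') :
    limitInt (2 * C ^ 2)⁻¹ < limitInt (2 * C' ^ 2)⁻¹ := by
  have hC' : 0 < C' := hC.trans h
  refine strictAntiOn_limitInt (mem_Ici.2 (by positivity)) (mem_Ici.2 (by positivity)) ?_
  exact inv_strictAnti₀ (by positivity)
    (mul_lt_mul_of_pos_left (pow_lt_pow_left₀ h hC.le two_ne_zero) two_pos)

/-! ### The root `λ_p^*` -/

/-- Raising `p` to `q` lowers `τ (l p)` below `1 / 2`, so a larger `λ` is needed to return to `1 /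
2`. -/
lemma strictMonoOn_of_tau_eq_half {l : ℕ → ℝ}
    (hl : ∀ p : ℕ, 2 ≤ p → 1 ≤ l p ∧ tau (l p) p = 1 / 2) : StrictMonoOn l (Ici 2) := by
  intro p hp q hq hpq
  have hp' := hl p hp
  have hq' := hl q hq
  have hp0 : 0 < l p := by linarith
  have h := strictAntiOn_tau_nat hp0 (mem_Ici.2 (one_le_two.trans hp))
    (mem_Ici.2 (one_le_two.trans hq)) hpq
  simp only [hp'.2] at h
  rw [← hq'.2] at h
  exact ((strictMonoOn_tau hq).lt_iff_lt (mem_Ioi.2 hp0) (mem_Ioi.2 (by linarith))).1 h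

lemma eventually_rpow_lt_of_tau_eq_half {l : ℕ → ℝ}
    (hl : ∀ p : ℕ, 2 ≤ p → 1 ≤ l p ∧ tau (l p) p = 1 / 2) {ε : ℝ} (hε : 0 < ε) :
    ∀ᶠ p : ℕ in atTop, (p : ℝ) ^ ((1 : ℝ) / 2 - ε) < l p ∧ l p < (p : ℝ) ^ ((1 : ℝ) / 2 + ε) := by
  obtain ⟨C, hC, hC1, -⟩ := exists_limitInt_eq_half
  have hlo : limitInt (2 * (C / 2) ^ 2)⁻¹ < 1 / 2 :=
    hC1 ▸ limitInt_lt_of_lt (half_pos hC) (half_lt_self hC)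
  have hhi : 1 / 2 < limitInt (2 * (2 * C) ^ 2)⁻¹ :=
    hC1 ▸ limitInt_lt_of_lt hC (by linarith)
  have h1 : Tendsto (fun p : ℕ => (p : ℝ) ^ (-ε)) atTop (𝓝 0) :=
    (tendsto_rpow_neg_atTop hε).comp tendsto_natCast_atTop_atTop
  have h2 : Tendsto (fun p : ℕ => (p : ℝ) ^ ε) atTop atTop :=
    (tendsto_rpow_atTop hε).comp tendsto_natCast_atTop_atTop
  -- In the limit `C / 2` and `2 C` give values strictly below and above `1 / 2`, so the root lies
  -- between `(C / 2) √p` and `2 C √p`; eventually `p ^ (-ε) < C / 2` and `2 C < p ^ ε`.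
  filter_upwards [eventually_ge_atTop 2,
    (tendsto_tau_mul_sqrt (half_pos hC)).eventually (gt_mem_nhds hlo),
    (tendsto_tau_mul_sqrt (mul_pos two_pos hC)).eventually (lt_mem_nhds hhi),
    h1.eventually (gt_mem_nhds (half_pos hC)), h2.eventually_gt_atTop (2 * C)]
    with p hp h3 h4 h5 h6
  have hp0 : (0 : ℝ) < p := by positivity
  have hs : 0 < √(p : ℝ) := Real.sqrt_pos.2 hp0
  obtain ⟨hl1, hl2⟩ := hl p hp
  have hl0 : 0 < l p := by linarith
  rw [← hl2] at h3 h4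
  have h7 := ((strictMonoOn_tau hp).lt_iff_lt (mem_Ioi.2 (by positivity)) (mem_Ioi.2 hl0)).1 h3
  have h8 := ((strictMonoOn_tau hp).lt_iff_lt (mem_Ioi.2 hl0) (mem_Ioi.2 (by positivity))).1 h4
  rw [sub_eq_add_neg, Real.rpow_add hp0, Real.rpow_add hp0, ← Real.sqrt_eq_rpow]
  refine ⟨lt_trans ?_ h7, h8.trans ?_⟩
  · rw [mul_comm]
    exact mul_lt_mul_of_pos_right h5 hs
  · rw [mul_comm (√(p : ℝ))]
    exact mul_lt_mul_of_pos_right h6 hs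

end SignPCA

theorem mainTheorem2 :
    ∃ τ : ℝ → ℕ → ℝ,
      -- `τ(lam, p)` is the leading eigenvalue of the spatial sign covariance matrix, and the
      -- spectrum of that matrix is `τ, τ₀, …, τ₀`
      (∀ (p : ℕ) (lam σ : ℝ) (O : Matrix (Fin p) (Fin p) ℝ) (P : Measure (SignPCA.E p)),
        1 ≤ p → 1 ≤ lam → 0 < σ → O ∈ Matrix.orthogonalGroup (Fin p) ℝ →
        P ∈ SignPCA.ellipticalFamily O (SignPCA.scaleMatrix p σ lam) →
          SignPCA.IsLeadingEigenvalue (SignPCA.spatialSignCov P) (τ lam p) ∧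
          (SignPCA.spatialSignCov P).charpoly =
            (Polynomial.X - Polynomial.C (τ lam p)) *
              (Polynomial.X - Polynomial.C (SignPCA.tailEigenvalue τ lam p)) ^ (p - 1)) ∧
      -- integral representation
      (∀ (p : ℕ) (lam : ℝ), 1 ≤ p → 1 ≤ lam →
        τ lam p = lam ^ 2 / 2 *
          ∫ x in Ioi (0 : ℝ),
            (1 + lam ^ 2 * x) ^ (-(3 : ℝ) / 2) * (1 + x) ^ ((1 - (p : ℝ)) / 2)) ∧
      -- (1)
      (∀ lam : ℝ, 1 < lam →
        StrictAntiOn (fun p : ℕ => τ lam p) (Ici 1) ∧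
        (fun p : ℕ => τ lam p - lam ^ 2 / (p : ℝ)) =o[atTop] (fun p : ℕ => 1 / (p : ℝ))) ∧
      -- (2)
      (∀ lam : ℝ, 1 < lam →
        StrictAntiOn (fun p : ℕ => SignPCA.tailEigenvalue τ lam p) (Ici 2) ∧
        (fun p : ℕ => SignPCA.tailEigenvalue τ lam p - 1 / (p : ℝ))
          =o[atTop] (fun p : ℕ => 1 / (p : ℝ))) ∧
      -- (3)
      (∀ p : ℕ, 2 ≤ p →
        StrictMonoOn (fun lam : ℝ => τ lam p) (Ici 1) ∧
        Tendsto (fun lam : ℝ => τ lam p) atTop (𝓝 1)) ∧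
      -- (4)
      (∃ lamStar : ℕ → ℝ,
        (∀ p : ℕ, 2 ≤ p →
          1 ≤ lamStar p ∧ ∀ lam : ℝ, 1 ≤ lam → (τ lam p = 1 / 2 ↔ lam = lamStar p)) ∧
        StrictMonoOn lamStar (Ici 2) ∧
        ∀ ε : ℝ, 0 < ε → ∀ᶠ p : ℕ in atTop,
          (p : ℝ) ^ ((1 : ℝ) / 2 - ε) < lamStar p ∧
          lamStar p < (p : ℝ) ^ ((1 : ℝ) / 2 + ε)) ∧
      -- (5)
      (∃ C : ℝ, 0 < C ∧
        Tendsto (fun p : ℕ => τ (C * √(p : ℝ)) p) atTop (𝓝 (1 / 2)) ∧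
        (∀ C' : ℝ, 0 < C' →
          Tendsto (fun p : ℕ => τ (C' * √(p : ℝ)) p) atTop (𝓝 (1 / 2)) → C' = C) ∧
        |C - 1.634| < 0.0005) := by
  refine ⟨SignPCA.tau, ?_, fun _ _ _ _ => rfl, fun lam hl => ⟨?_, ?_⟩, fun lam hl => ⟨?_, ?_⟩,
    fun p hp => ⟨?_, ?_⟩, ?_, ?_⟩
  · intro p lam σ O P hp hl hσ hO hP
    obtain ⟨n, rfl⟩ : ∃ n, p = n + 1 := ⟨p - 1, by omega⟩
    have h := SignPCA.charpoly_spatialSignCov hl hσ hO hP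
    exact ⟨SignPCA.isLeadingEigenvalue_of_charpoly h fun hn =>
      SignPCA.tailEigenvalue_le_tau hl (by omega), h⟩
  · exact SignPCA.strictAntiOn_tau_nat (by linarith)
  · exact SignPCA.isLittleO_one_div_of_tendsto (SignPCA.tendsto_mul_tau hl.le)
  · exact SignPCA.strictAntiOn_tailEigenvalue hl.le
  · exact SignPCA.isLittleO_one_div_of_tendsto (SignPCA.tendsto_mul_tailEigenvalue hl.le)
  · exact (SignPCA.strictMonoOn_tau hp).mono fun x hx => mem_Ioi.2 (one_pos.trans_le hx)
  · exact SignPCA.tendsto_tau_atTop (by omega)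
  · have h : ∀ p : ℕ, ∃ lam : ℝ, 2 ≤ p → 1 ≤ lam ∧ SignPCA.tau lam p = 1 / 2 := fun p => by
      by_cases hp : 2 ≤ p
      · obtain ⟨lam, hlam⟩ := SignPCA.exists_tau_eq_half hp
        exact ⟨lam, fun _ => hlam⟩
      · exact ⟨0, fun h => absurd h hp⟩
    choose l hl using h
    refine ⟨l, fun p hp => ⟨(hl p hp).1, fun lam hlam => ⟨fun h => ?_, fun h => ?_⟩⟩,
      SignPCA.strictMonoOn_of_tau_eq_half hl,
      fun ε hε => SignPCA.eventually_rpow_lt_of_tau_eq_half hl hε⟩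
    · exact (SignPCA.strictMonoOn_tau hp).injOn (mem_Ioi.2 (by linarith))
        (mem_Ioi.2 (by linarith [(hl p hp).1])) (h.trans (hl p hp).2.symm)
    · rw [h, (hl p hp).2]
  · obtain ⟨C, hC, hC1, hC2⟩ := SignPCA.exists_limitInt_eq_half
    refine ⟨C, hC, hC1 ▸ SignPCA.tendsto_tau_mul_sqrt hC, fun C' hC' h => ?_, hC2⟩
    have h1 := tendsto_nhds_unique h (SignPCA.tendsto_tau_mul_sqrt hC')
    -- Both `C` and `C'` have limit value `1 / 2`, which strict monotonicity of the limit in `C`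
    -- forbids unless they agree.
    rcases lt_trichotomy C' C with h2 | h2 | h2
    · linarith [SignPCA.limitInt_lt_of_lt hC' h2]
    · exact h2
    · linarith [SignPCA.limitInt_lt_of_lt hC h2]
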